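/- Let $n\in\mathbb N$, let $\Omega\subset\mathbb R^n$ be bounded and open, let $s_i\in(0,1)$, $p_i\in(1,\infty)$ and $\delta_i>0$ for $i=1,\dots,n$, and put $$\overline{\vec s}=\Big(\frac1n\sum_i\frac1{s_i}\Big)^{-1},\qquad \overline{\vec s\vec p}=\Big(\frac1n\sum_i\frac1{s_ip_i}\Big)^{-1},\qquad \vec p^{\,*}=\frac{n\,\overline{\vec s\vec p}/\overline{\vec s}}{n-\overline{\vec s\vec p}} .$$ Assume $\overline{\vec s\vec p}<n$ and $\max_i p_i<\vec p^{\,*}$. For measurable $u$ on $\mathbb R^n$ (functions equal a.e. are identified) let $D_i^hu(x)=u(x+he_i)-u(x)$ and $$[u]^i=\int_{\mathbb R^n}\int_{|h|\le\delta_i}\frac{|D_i^hu(x)|^{p_i}}{|h|^{1+s_ip_i}}\,dh\,dx .$$ Let $W_0=W_0^{\vec s,\vec p,\vec\delta}(\Omega)$ be the space of all $u$ with $u\in L^{p_i}(\mathbb R^n)$ and $[u]^i<\infty$ for every $i$ and $u=0$ a.e. outside $\Omega$, with the norm $\|u\|=\sum_i\big(([u]^i)^{1/p_i}+\|u\|_{p_i}\big)$.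 Fix weights $w_i>0$ (the choices $w_i=1$ and $w_i=1/p_i$ being the usual normalizations) and let $$J_{\vec\delta}(u)=\sum_i \frac{w_i}{\delta_i^{p_i(1-s_i)}}[u]^i,\qquad \langle Au,v\rangle=\sum_i\frac{w_ip_i}{\delta_i^{p_i(1-s_i)}}\int_{\mathbb R^n}\int_{|h|\le\delta_i}\frac{|D_i^hu|^{p_i-2}D_i^hu\,D_i^hv}{|h|^{1+s_ip_i}}\,dh\,dx ,$$ where $A$ is the peridynamic fractional anisotropic $\vec p$-Laplacian. Let $f\in L^{(\vec p^{\,*})'}(\Omega)$, where $(\vec p^{\,*})'=\vec p^{\,*}/(\vec p^{\,*}-1)$. A weak solution of $Au=f$ in $\Omega$, $u=0$ in $\mathbb R^n\setminus\Omega$, is a $u\in W_0$ with $\langle Au,v\rangle=\int_\Omega fv\,dx$ for all $v\in W_0$. Then: (i) for all $u,v\in W_0$ the integrals $\int_\Omega fv\,dx$ and those in $\langle Au,v\rangle$ converge absolutely, and $Au$ is the Fréchet derivative of $J_{\vec\delta}$ at $u$ on $W_0$; (ii) there is exactly one weak solution; (iii) an element of $W_0$ is a weak solution if and only if it minimizes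 $I(v)=J_{\vec\delta}(v)-\int_\Omega fv\,dx$ over $W_0$; (iv) $I$ is strictly convex on $W_0$, coercive ($I(v)\to\infty$ as $\|v\|\to\infty$ in $W_0$) and continuous on $W_0$ for the norm. -/

import Mathlib

open MeasureTheory Filter Topology Asymptotics

namespace Peridynamic

noncomputable section

/-- `ℝⁿ`. -/
abbrev Pt (n : ℕ) : Type := EuclideanSpace ℝ (Fin n)

/-- Real functions on `ℝⁿ`, measurable and identified when equal almost everywhere. -/
abbrev Fn (n : ℕ) : Type := Pt n →ₘ[(volume : Measure (Pt n))] ℝ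

/-- The harmonic mean `( (1/n) ∑ᵢ 1/aᵢ )⁻¹`. -/
def harmonicMean {n : ℕ} (a : Fin n → ℝ) : ℝ := ((1 / (n : ℝ)) * ∑ i, 1 / a i)⁻¹

/-- The mean exponent `( (1/n) ∑ᵢ 1/(sᵢ pᵢ) )⁻¹`. -/
def meanSP {n : ℕ} (s p : Fin n → ℝ) : ℝ := harmonicMean (fun i => s i * p i)

/-- The critical Sobolev exponent `p* = (n · mean(sp) / mean(s)) / (n - mean(sp))`. -/
def criticalExponent {n : ℕ} (s p : Fin n → ℝ) : ℝ :=
  ((n : ℝ) * meanSP s p / harmonicMean s) / ((n : ℝ) - meanSP s p)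

/-- The difference `u(x + h eᵢ) - u(x)` as a function of `(x, h)`. -/
def diffQ {n : ℕ} (i : Fin n) (u : Fn n) (z : Pt n × ℝ) : ℝ :=
  u (z.1 + z.2 • EuclideanSpace.single i (1 : ℝ)) - u z.1

/-- The measure `dx dh` on `ℝⁿ × {|h| ≤ δ}`. -/
def slab (n : ℕ) (δ : ℝ) : Measure (Pt n × ℝ) :=
  (volume : Measure (Pt n)).prod ((volume : Measure ℝ).restrict {h | |h| ≤ δ})

/-- `[u]ⁱ_{s,p,δ} = ∫_{ℝⁿ} ∫_{|h| ≤ δ} |u(x + h eᵢ) - u(x)|ᵖ / |h|^{1+sp} dh dx`, in `[0, ∞]`. -/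
def gagliardo {n : ℕ} (i : Fin n) (s p δ : ℝ) (u : Fn n) : ENNReal :=
  ∫⁻ z, ENNReal.ofReal (|diffQ i u z| ^ p / |z.2| ^ (1 + s * p)) ∂(slab n δ)

/-- The anisotropic peridynamic Sobolev space on `ℝⁿ`:
`u ∈ L^{pᵢ}(ℝⁿ)` and `[u]ⁱ_{sᵢ,pᵢ,δᵢ} < ∞` for every `i`. -/
def W {n : ℕ} (s p δ : Fin n → ℝ) : Set (Fn n) :=
  {u | ∀ i, MemLp u (ENNReal.ofReal (p i)) volume ∧ gagliardo i (s i) (p i) (δ i) u < ⊤}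

/-- The functions of `W` that vanish (almost everywhere) outside `Ω`. -/
def W0 {n : ℕ} (s p δ : Fin n → ℝ) (Ω : Set (Pt n)) : Set (Fn n) :=
  {u | u ∈ W s p δ ∧ ∀ᵐ x ∂(volume : Measure (Pt n)), x ∉ Ω → u x = 0}

/-- The norm `∑ᵢ ( ([u]ⁱ)^{1/pᵢ} + ‖u‖_{pᵢ} )` of the space `W`. -/
def wNorm {n : ℕ} (s p δ : Fin n → ℝ) (u : Fn n) : ℝ :=
  ∑ i, ((gagliardo i (s i) (p i) (δ i) u).toReal ^ (1 / p i)
    + (eLpNorm u (ENNReal.ofReal (p i)) volume).toReal)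

/-- The directional energy `Jⁱ_δ(u) = δ^{-p(1-s)} [u]ⁱ_{s,p,δ}`. -/
def dirEnergy {n : ℕ} (i : Fin n) (s p δ : ℝ) (u : Fn n) : ℝ :=
  1 / δ ^ (p * (1 - s)) * (gagliardo i s p δ u).toReal

/-- The integrand `|Dᵢu|^{p-2} Dᵢu Dᵢv / |h|^{1+sp}`, where `Dᵢu = u(x + h eᵢ) - u(x)`. -/
def pairingIntegrand {n : ℕ} (i : Fin n) (s p : ℝ) (u v : Fn n) (z : Pt n × ℝ) : ℝ :=
  |diffQ i u z| ^ (p - 2) * diffQ i u z * diffQ i v z / |z.2| ^ (1 + s * p)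

/-- `⟨(Jⁱ_δ)'(u), v⟩ = p δ^{-p(1-s)} ∫∫ |Dᵢu|^{p-2} Dᵢu Dᵢv / |h|^{1+sp} dh dx`. -/
def dirPairing {n : ℕ} (i : Fin n) (s p δ : ℝ) (u v : Fn n) : ℝ :=
  p / δ ^ (p * (1 - s)) * ∫ z, pairingIntegrand i s p u v z ∂(slab n δ)

/-- The energy `J_δ(u) = ∑ᵢ wᵢ Jⁱ_{δᵢ}(u)` with weights `wᵢ`. The weights `wᵢ = 1` give the plain
sum; `wᵢ = 1/pᵢ` give the energy whose derivative is `∑ᵢ (1/pᵢ) (Jⁱ_{δᵢ})'`. -/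
def energy {n : ℕ} (w s p δ : Fin n → ℝ) (u : Fn n) : ℝ :=
  ∑ i, w i * dirEnergy i (s i) (p i) (δ i) u

/-- The peridynamic fractional anisotropic `p`-Laplacian
`⟨(-Δ)u, v⟩ = ∑ᵢ wᵢ ⟨(Jⁱ_{δᵢ})'(u), v⟩`. -/
def pLaplacian {n : ℕ} (w s p δ : Fin n → ℝ) (u v : Fn n) : ℝ :=
  ∑ i, w i * dirPairing i (s i) (p i) (δ i) u v

/-- `u` is a weak solution of `(-Δ)u = f` in `Ω`, `u = 0` in `ℝⁿ \ Ω`. -/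
def IsWeakSolution {n : ℕ} (w s p δ : Fin n → ℝ) (Ω : Set (Pt n)) (f : Pt n → ℝ) (u : Fn n) :
    Prop :=
  u ∈ W0 s p δ Ω ∧ ∀ v ∈ W0 s p δ Ω, pLaplacian w s p δ u v = ∫ x in Ω, f x * v x

/-- The functional `I(v) = J_δ(v) - ∫_Ω f v`. -/
def functional {n : ℕ} (w s p δ : Fin n → ℝ) (Ω : Set (Pt n)) (f : Pt n → ℝ) (v : Fn n) : ℝ :=
  energy w s p δ v - ∫ x in Ω, f x * v x

/-- `L` is the Fréchet derivative at `u` of `F` on the linear space `V` with norm `N`. -/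
structure IsFrechetDerivative {n : ℕ} (V : Set (Fn n)) (N : Fn n → ℝ) (F : Fn n → ℝ) (u : Fn n)
    (L : Fn n → ℝ) : Prop where
  linear : ∀ v₁ ∈ V, ∀ v₂ ∈ V, ∀ a b : ℝ, L (a • v₁ + b • v₂) = a * L v₁ + b * L v₂
  bounded : ∃ C : ℝ, ∀ v ∈ V, |L v| ≤ C * N v
  approx : (fun v => F (u + v) - F u - L v) =o[comap N (𝓝 0) ⊓ 𝓟 V] N

end

end Peridynamic

namespace Peridynamic

/-! ### Elementary inequalities for `|·|ᵖ` -/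

/-! The kernel `|h|^{-1-sp}` is absorbed into a measure, so each seminorm becomes `∫ |Dᵢu|^p` for a
difference `Dᵢu` linear in `u`. Differentiability, tangent inequality, strict convexity and uniform
convexity of the energy are then integrated forms of scalar inequalities for `|·|^p`. Boundedness of
`Ω` enters through a directional Poincaré inequality (`poincare`): stepping `N` times in direction
`eᵢ` leaves `Ω`, so `u` is a telescoping sum of differences. Hence the seminorms alone control the
norm, and any single one of them determines `u`. The load is continuous because `W₀` embeds in the
critical Lebesgue space (`exists_eLpNorm_le`). If `u` is large on a set and vanishes off a set `E`,
then at least half of any box of volume at least `2|E|` moves a point out of `E`; following a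
coordinate path inside the box bounds the measure of the set by the directional seminorms
(`volume_level_le`). Applied to dyadic truncations, with box sides tuned to the critical exponent,
this gives first a weak-type bound, and then a strong one, since the seminorm powers of the
truncations sum to at most that of `u`. The functional is therefore coercive, continuous and
strictly convex. The midpoint inequality (`semi_sub_le_gap`) makes minimizing sequences Cauchy, and
completeness yields a minimizer without weak compactness. The tangent inequality and the first
variation identify minimizers with weak solutions; strict convexity gives uniqueness. -/

theorem abs_rpow_sub_two_mul_self_mul_self {p : ℝ} (hp : 1 < p) (a : ℝ) :
    |a| ^ (p - 2) * a * a = |a| ^ p := by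
  rcases eq_or_ne a 0 with rfl | ha
  -- At `a = 0` the value assigned to `|0| ^ (p - 2)` is irrelevant, even for `p < 2`, because a
  -- factor `a` vanishes.
  · simp [Real.zero_rpow (by linarith : p ≠ 0)]
  · have h : 0 < |a| := abs_pos.2 ha
    rw [mul_assoc, ← abs_mul_abs_self a, ← pow_two, ← Real.rpow_natCast, ← Real.rpow_add h]
    norm_num

theorem abs_abs_rpow_sub_two_mul_self {p : ℝ} (hp : 1 < p) (a : ℝ) :
    |(|a| ^ (p - 2) * a)| = |a| ^ (p - 1) := by
  rcases eq_or_ne a 0 with rfl | ha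
  · simp [Real.zero_rpow (by linarith : p - 1 ≠ 0)]
  · have h : 0 < |a| := abs_pos.2 ha
    rw [abs_mul, abs_of_nonneg (Real.rpow_nonneg h.le _)]
    nth_rw 2 [← Real.rpow_one |a|]
    rw [← Real.rpow_add h]
    ring_nf

/-- Near `t = 0` this is differentiability of `|·|^p` at `1`; away from `0` every term on the left
is dominated by a multiple of `|t|^p`. No case distinction at `p = 2` is needed. -/
theorem abs_rpow_remainder_one {p ε : ℝ} (hp : 1 < p) (hε : 0 < ε) :
    ∃ C, 0 ≤ C ∧ ∀ t : ℝ, |(|1 + t| ^ p - 1 - p * t)| ≤ ε * |t| + C * |t| ^ p := by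
  have hd := (hasDerivAt_abs_rpow 1 hp).isLittleO
  rw [Asymptotics.isLittleO_iff] at hd
  obtain ⟨η, hη, h⟩ := Metric.eventually_nhds_iff.1 (hd hε)
  have hη' : 0 < 1 / η := by positivity
  -- The three summands dominate `|1 + t|^p`, `1` and `p|t|` respectively when `|t| ≥ η`.
  refine ⟨(1 / η + 1) ^ p + (1 / η) ^ p + p * η * (1 / η) ^ p, by positivity, fun t => ?_⟩
  have hp0 : 0 ≤ |t| ^ p := by positivity
  rcases lt_or_ge |t| η with ht | ht
  · have := @h (1 + t) (by simpa using ht)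
    simp only [abs_one, Real.one_rpow, mul_one, add_sub_cancel_left, smul_eq_mul,
      Real.norm_eq_abs] at this
    rw [mul_comm t p] at this
    have h2 : 0 ≤ ((1 / η + 1) ^ p + (1 / η) ^ p + p * η * (1 / η) ^ p) * |t| ^ p := by positivity
    linarith
  · have h1 : 1 ≤ 1 / η * |t| := by
      rw [one_div, inv_mul_eq_div, le_div_iff₀ hη]; linarith
    have e1 : |1 + t| ^ p ≤ (1 / η + 1) ^ p * |t| ^ p := by
      rw [← Real.mul_rpow (by positivity) (abs_nonneg t)]
      refine Real.rpow_le_rpow (abs_nonneg _) ?_ (by linarith)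
      calc |1 + t| ≤ |(1 : ℝ)| + |t| := abs_add_le _ _
        _ ≤ _ := by rw [abs_one]; linarith
    have e2 : 1 ≤ (1 / η) ^ p * |t| ^ p := by
      rw [← Real.mul_rpow (by positivity) (abs_nonneg t)]
      exact Real.one_le_rpow h1 (by linarith)
    have e3 : |t| ≤ η * (1 / η) ^ p * |t| ^ p := by
      rw [mul_assoc, ← Real.mul_rpow (by positivity) (abs_nonneg t)]
      calc |t| = η * (1 / η * |t|) := by field_simp
        _ ≤ _ := by
          gcongr
          exact Real.self_le_rpow_of_one_le h1 hp.le
    have e4 : |(|1 + t| ^ p - 1 - p * t)| ≤ |1 + t| ^ p + 1 + p * |t| := by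
      have a1 : |p * t| = p * |t| := by rw [abs_mul, abs_of_pos (by linarith)]
      have a2 := abs_le.1 a1.le
      have a3 : 0 ≤ |1 + t| ^ p := by positivity
      rw [abs_le]; constructor <;> linarith
    have e5 : p * |t| ≤ p * (η * (1 / η) ^ p * |t| ^ p) := by gcongr
    have e6 : 0 ≤ ε * |t| := by positivity
    linarith

/-- Homogeneity of degree `p` reduces this to base point `1` with `t = b / a`; only `a = 0` is
separate. -/
theorem abs_rpow_remainder {p ε : ℝ} (hp : 1 < p) (hε : 0 < ε) :
    ∃ C, 0 ≤ C ∧ ∀ a b : ℝ, |(|a + b| ^ p - |a| ^ p - p * (|a| ^ (p - 2) * a * b))|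
      ≤ ε * (|a| ^ (p - 1) * |b|) + C * |b| ^ p := by
  obtain ⟨C, hC, h⟩ := abs_rpow_remainder_one hp hε
  refine ⟨C + 1, by positivity, fun a b => ?_⟩
  rcases eq_or_ne a 0 with rfl | ha
  · have hb : 0 ≤ |b| ^ p := by positivity
    simp only [zero_add, abs_zero, Real.zero_rpow (by linarith : p ≠ 0), mul_zero, zero_mul,
      sub_zero, Real.zero_rpow (by linarith : p - 1 ≠ 0), abs_of_nonneg hb]
    nlinarith
  · have ha' : 0 < |a| := abs_pos.2 ha
    have hap : 0 < |a| ^ p := by positivity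
    have e0 : a + b = a * (1 + b / a) := by field_simp
    have e1 : |a| ^ (p - 2) * a * b = |a| ^ p * (b / a) := by
      rw [← abs_rpow_sub_two_mul_self_mul_self hp a]; field_simp
    have e2 : |a| ^ (p - 1) * |b| = |a| ^ p * |b / a| := by
      rw [Real.rpow_sub_one ha'.ne', abs_div]; field_simp
    have e3 : |b| ^ p = |a| ^ p * |b / a| ^ p := by
      rw [← Real.mul_rpow ha'.le (abs_nonneg _), ← abs_mul]; congr 2; field_simp
    rw [e1, e2, e3, e0, abs_mul, Real.mul_rpow ha'.le (abs_nonneg _)]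
    have := h (b / a)
    have e4 : |a| ^ p * |1 + b / a| ^ p - |a| ^ p - p * (|a| ^ p * (b / a))
        = |a| ^ p * (|1 + b / a| ^ p - 1 - p * (b / a)) := by ring
    rw [e4, abs_mul, abs_of_pos hap]
    have h3 : 0 ≤ |b / a| ^ p := by positivity
    calc _ ≤ |a| ^ p * (ε * |b / a| + C * |b / a| ^ p) := by gcongr
      _ ≤ _ := by nlinarith [mul_nonneg hap.le h3]

/-- Young's inequality applied to `|b| |a|^(p-1)` gives the tangent line inequality directly,
without differentiation. -/
theorem abs_rpow_tangent {p : ℝ} (hp : 1 < p) (a b : ℝ) :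
    |a| ^ p + p * (|a| ^ (p - 2) * a * (b - a)) ≤ |b| ^ p := by
  have h1 := Real.young_inequality_of_nonneg (abs_nonneg b)
    (Real.rpow_nonneg (abs_nonneg a) (p - 1)) (Real.HolderConjugate.conjExponent hp)
  have hp1 : p - 1 ≠ 0 := by linarith
  rw [← Real.rpow_mul (abs_nonneg a), Real.conjExponent] at h1
  have e1 : (p - 1) * (p / (p - 1)) = p := by field_simp
  rw [e1] at h1
  have h2 : |a| ^ (p - 2) * a * b ≤ |b| * |a| ^ (p - 1) := by
    rw [← abs_abs_rpow_sub_two_mul_self hp a, ← abs_mul, mul_comm b]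
    exact le_abs_self _
  have h3 := abs_rpow_sub_two_mul_self_mul_self hp a
  have h4 : p * (|b| * |a| ^ (p - 1)) ≤ |b| ^ p + (p - 1) * |a| ^ p := by
    calc _ ≤ p * (|b| ^ p / p + |a| ^ p / (p / (p - 1))) := by gcongr
      _ = _ := by field_simp
  have h5 : p * (|a| ^ (p - 2) * a * b) ≤ p * (|b| * |a| ^ (p - 1)) := by gcongr
  have h6 : |a| ^ p + p * (|a| ^ (p - 2) * a * (b - a))
      = |a| ^ p + p * (|a| ^ (p - 2) * a * b) - p * (|a| ^ (p - 2) * a * a) := by ring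
  rw [h6, h3]; linarith

/-- The triangle inequality reduces to strict convexity of `x^p` on `[0, ∞)`. That is not strict
when `|a| = |b|`; there `a = -b`, and the loss is in the triangle inequality instead. -/
theorem strictConvexOn_abs_rpow {p : ℝ} (hp : 1 < p) :
    StrictConvexOn ℝ Set.univ (fun x : ℝ => |x| ^ p) := by
  refine ⟨convex_univ, fun a _ b _ hab s t hs ht hst => ?_⟩
  simp only [smul_eq_mul]
  have hle : |s * a + t * b| ≤ s * |a| + t * |b| := by
    calc _ ≤ |s * a| + |t * b| := abs_add_le _ _
      _ = _ := by rw [abs_mul, abs_mul, abs_of_pos hs, abs_of_pos ht]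
  rcases eq_or_ne |a| |b| with h | h
  · have hba : a = -b := (abs_eq_abs.1 h).resolve_left hab
    have hb : 0 < |b| := by
      rw [abs_pos]; rintro rfl; simp [hba] at hab
    have h1 : |s * a + t * b| < |b| := by
      have : s * a + t * b = (t - s) * b := by rw [hba]; ring
      rw [this, abs_mul]
      have : |t - s| < 1 := by rw [abs_lt]; constructor <;> linarith
      nlinarith
    rw [h, ← add_mul, hst, one_mul]
    exact Real.rpow_lt_rpow (abs_nonneg _) h1 (by linarith)
  · calc _ ≤ (s * |a| + t * |b|) ^ p :=
        Real.rpow_le_rpow (abs_nonneg _) hle (by linarith)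
      _ < _ := (strictConvexOn_rpow hp).2 (abs_nonneg a) (abs_nonneg b) h hs ht hst

/-- A quantitative uniform convexity valid for all `p > 1` at once, replacing Clarkson's
inequalities. Both sides are homogeneous, so it suffices to argue by compactness on the unit sphere
of the pair `(a, b)`. -/
theorem abs_rpow_midpoint_gap {p ε : ℝ} (hp : 1 < p) (hε : 0 < ε) :
    ∃ C, 0 ≤ C ∧ ∀ a b : ℝ, |a - b| ^ p ≤ ε * (|a| ^ p + |b| ^ p)
      + C * ((1 / 2) * |a| ^ p + (1 / 2) * |b| ^ p - |(1 / 2) * a + (1 / 2) * b| ^ p) := by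
  have hp0 : 0 < p := by linarith
  set gap : ℝ × ℝ → ℝ := fun z =>
    (1 / 2) * |z.1| ^ p + (1 / 2) * |z.2| ^ p - |(1 / 2) * z.1 + (1 / 2) * z.2| ^ p with hgap
  have habs : ∀ f : ℝ × ℝ → ℝ, Continuous f → Continuous fun z => |f z| ^ p :=
    fun f hf => hf.abs.rpow_const fun _ => Or.inr hp0.le
  have hgc : Continuous gap := by
    refine (((habs _ continuous_fst).const_mul _).add ((habs _ continuous_snd).const_mul _)).sub
      (habs _ ?_)
    fun_prop
  have hdc : Continuous fun z : ℝ × ℝ => |z.1 - z.2| ^ p := habs _ (by fun_prop)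
  have hg0 : ∀ z, 0 ≤ gap z := fun z => by
    have := (strictConvexOn_abs_rpow hp).convexOn.2 (Set.mem_univ z.1) (Set.mem_univ z.2)
      (by norm_num : (0 : ℝ) ≤ 1 / 2) (by norm_num : (0 : ℝ) ≤ 1 / 2) (by norm_num)
    simpa [hgap] using this
  have hK : IsCompact (Metric.sphere (0 : ℝ × ℝ) 1 ∩ {z | ε ≤ |z.1 - z.2| ^ p}) :=
    (isCompact_sphere _ _).inter_right (isClosed_le continuous_const hdc)
  -- Where `|a - b|^p ≥ ε` the points are distinct, so strict convexity and compactness give a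
  -- positive lower bound `m` for the gap.
  obtain ⟨m, hm, hmK⟩ := hK.exists_forall_le' hgc.continuousOn (a := 0) (fun z hz => by
    have hne : z.1 ≠ z.2 := by
      intro h
      have := hz.2
      simp only [Set.mem_ofPred_eq, h, sub_self, abs_zero, Real.zero_rpow hp0.ne'] at this
      linarith
    have := (strictConvexOn_abs_rpow hp).2 (Set.mem_univ z.1) (Set.mem_univ z.2) hne
      (by norm_num : (0 : ℝ) < 1 / 2) (by norm_num : (0 : ℝ) < 1 / 2) (by norm_num)
    simpa [hgap] using this)
  have hsphere : ∀ z : ℝ × ℝ, ‖z‖ = 1 →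
      |z.1 - z.2| ^ p ≤ ε * (|z.1| ^ p + |z.2| ^ p) + 2 ^ p / m * gap z := by
    intro z hz
    have h1 : |z.1| ≤ 1 := hz ▸ norm_fst_le z
    have h2 : |z.2| ≤ 1 := hz ▸ norm_snd_le z
    have hn1 : 0 ≤ |z.1| ^ p := by positivity
    have hn2 : 0 ≤ |z.2| ^ p := by positivity
    rcases le_or_gt ε (|z.1 - z.2| ^ p) with h | h
    · have hmz := hmK z ⟨by simpa using hz, h⟩
      have h3 : |z.1 - z.2| ^ p ≤ 2 ^ p := by
        refine Real.rpow_le_rpow (abs_nonneg _) ?_ hp0.le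
        calc _ ≤ |z.1| + |z.2| := abs_sub _ _
          _ ≤ 2 := by linarith
      have h4 : (2 : ℝ) ^ p ≤ 2 ^ p / m * gap z := by
        rw [div_mul_eq_mul_div, le_div_iff₀ hm]
        gcongr
      have : 0 ≤ ε * (|z.1| ^ p + |z.2| ^ p) := by positivity
      linarith
    -- In the sup norm of `ℝ × ℝ`, one of the two coordinates has absolute value exactly `1`.
    · have h5 : 1 ≤ |z.1| ^ p + |z.2| ^ p := by
        rcases max_choice ‖z.1‖ ‖z.2‖ with h' | h' <;>
          rw [← Prod.norm_def, hz, Real.norm_eq_abs] at h' <;> rw [← h', Real.one_rpow] <;> linarith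
      have h6 : 0 ≤ 2 ^ p / m * gap z := mul_nonneg (by positivity) (hg0 z)
      nlinarith
  refine ⟨2 ^ p / m, by positivity, fun a b => ?_⟩
  rcases eq_or_ne ((a, b) : ℝ × ℝ) 0 with h0 | h0
  · obtain ⟨rfl, rfl⟩ := Prod.mk_eq_zero.1 h0
    simp [Real.zero_rpow hp0.ne']
  · set r := ‖((a, b) : ℝ × ℝ)‖ with hr
    have hr0 : 0 < r := norm_pos_iff.2 h0
    have key := hsphere (a / r, b / r) (by
      have : ((a / r, b / r) : ℝ × ℝ) = r⁻¹ • (a, b) := by ext <;> simp <;> ring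
      rw [this, norm_smul, norm_inv, norm_norm, ← hr, inv_mul_cancel₀ hr0.ne'])
    have hrp : 0 < r ^ p := by positivity
    have hdiv : ∀ x : ℝ, |x / r| ^ p = |x| ^ p / r ^ p := fun x => by
      rw [abs_div, abs_of_pos hr0, Real.div_rpow (abs_nonneg _) hr0.le]
    simp only [hgap] at key
    have e1 : a / r - b / r = (a - b) / r := by ring
    have e2 : 1 / 2 * (a / r) + 1 / 2 * (b / r) = (1 / 2 * a + 1 / 2 * b) / r := by ring
    rw [e1, e2, hdiv, hdiv, hdiv, hdiv] at key
    have := mul_le_mul_of_nonneg_left key hrp.le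
    field_simp at this ⊢
    linarith

theorem exists_mul_rpow_inv_le {p : ℝ} (hp : 1 < p) (c K : ℝ) (hc : 0 < c) :
    ∃ C, ∀ x : ℝ, 0 ≤ x → K * x ^ (1 / p) ≤ c * x + C := by
  have hp1 : p - 1 ≠ 0 := by linarith
  have hcp : 0 < (c * p) ^ (1 / p) := by positivity
  -- Young's inequality for `(c p x)^(1/p)` and `|K| / (c p)^(1/p)`: the first power is exactly `c
  -- x`, the second is this constant.
  refine ⟨(|K| / (c * p) ^ (1 / p)) ^ (p / (p - 1)) / (p / (p - 1)), fun x hx => ?_⟩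
  have h1 := Real.young_inequality_of_nonneg (a := (c * p * x) ^ (1 / p))
    (b := |K| / (c * p) ^ (1 / p)) (by positivity) (by positivity)
    (Real.HolderConjugate.conjExponent hp)
  rw [← Real.rpow_mul (by positivity), one_div_mul_cancel (by linarith), Real.rpow_one,
    Real.conjExponent, Real.mul_rpow (by positivity) hx] at h1
  have h2 : c * p * x / p = c * x := by field_simp
  have h3 : (c * p) ^ (1 / p) * x ^ (1 / p) * (|K| / (c * p) ^ (1 / p)) = |K| * x ^ (1 / p) := by
    field_simp
  rw [h2, h3] at h1
  refine le_trans ?_ h1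
  gcongr
  exact le_abs_self K

end Peridynamic

namespace Peridynamic

/-! ### The functional `∫ |U|ᵖ` on `Lᵖ` of a measure space -/

section Lp

variable {α : Type*} [MeasurableSpace α] {ν : Measure α} {p : ℝ}

theorem integrable_abs_rpow (hp : 1 < p) {U : α → ℝ} (hU : MemLp U (ENNReal.ofReal p) ν) :
    Integrable (fun z => |U z| ^ p) ν := by
  have h := hU.integrable_norm_rpow (by simp; linarith) ENNReal.ofReal_ne_top
  simpa [ENNReal.toReal_ofReal (by linarith : 0 ≤ p)] using h

theorem memLp_abs_rpow_sub_one (hp : 1 < p) {U : α → ℝ} (hU : MemLp U (ENNReal.ofReal p) ν) :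
    MemLp (fun z => |U z| ^ (p - 1)) (ENNReal.ofReal (Real.conjExponent p)) ν := by
  have h := hU.norm_rpow_div (ENNReal.ofReal (p - 1))
  rw [← ENNReal.ofReal_div_of_pos (by linarith)] at h
  simpa [ENNReal.toReal_ofReal (by linarith : 0 ≤ p - 1), Real.conjExponent] using h

theorem integrable_abs_rpow_sub_one_mul (hp : 1 < p) {U V : α → ℝ}
    (hU : MemLp U (ENNReal.ofReal p) ν) (hV : MemLp V (ENNReal.ofReal p) ν) :
    Integrable (fun z => |U z| ^ (p - 1) * |V z|) ν :=
  haveI : ENNReal.HolderConjugate (ENNReal.ofReal (Real.conjExponent p)) (ENNReal.ofReal p) :=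
    (Real.HolderConjugate.conjExponent hp).symm.ennrealOfReal
  MemLp.integrable_mul (memLp_abs_rpow_sub_one hp hU) hV.abs

theorem integral_abs_rpow_sub_one_mul_le (hp : 1 < p) {U V : α → ℝ}
    (hU : MemLp U (ENNReal.ofReal p) ν) (hV : MemLp V (ENNReal.ofReal p) ν) :
    ∫ z, |U z| ^ (p - 1) * |V z| ∂ν
      ≤ (∫ z, |U z| ^ p ∂ν) ^ (1 / Real.conjExponent p) * (∫ z, |V z| ^ p ∂ν) ^ (1 / p) := by
  have hp1 : p - 1 ≠ 0 := by linarith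
  have h := integral_mul_le_Lp_mul_Lq_of_nonneg (Real.HolderConjugate.conjExponent hp).symm
    (f := fun z => |U z| ^ (p - 1)) (g := fun z => |V z|) (μ := ν)
    (Eventually.of_forall fun z => by positivity) (Eventually.of_forall fun z => abs_nonneg _)
    (memLp_abs_rpow_sub_one hp hU) hV.abs
  have e : ∀ z, (|U z| ^ (p - 1)) ^ Real.conjExponent p = |U z| ^ p := fun z => by
    rw [← Real.rpow_mul (abs_nonneg _), Real.conjExponent]; congr 1; field_simp
  simpa only [e] using h

theorem aestronglyMeasurable_pairing {U V : α → ℝ} (hU : AEStronglyMeasurable U ν)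
    (hV : AEStronglyMeasurable V ν) :
    AEStronglyMeasurable (fun z => |U z| ^ (p - 2) * U z * V z) ν :=
  (((hU.aemeasurable.abs.pow_const _).mul hU.aemeasurable).mul
    hV.aemeasurable).aestronglyMeasurable

theorem integrable_pairing (hp : 1 < p) {U V : α → ℝ}
    (hU : MemLp U (ENNReal.ofReal p) ν) (hV : MemLp V (ENNReal.ofReal p) ν) :
    Integrable (fun z => |U z| ^ (p - 2) * U z * V z) ν := by
  refine (integrable_abs_rpow_sub_one_mul hp hU hV).mono (aestronglyMeasurable_pairing hU.1 hV.1)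
    (Eventually.of_forall fun z => ?_)
  rw [Real.norm_eq_abs, Real.norm_eq_abs, abs_mul, abs_abs_rpow_sub_two_mul_self hp]
  exact le_abs_self _

theorem abs_integral_pairing_le (hp : 1 < p) {U V : α → ℝ}
    (hU : MemLp U (ENNReal.ofReal p) ν) (hV : MemLp V (ENNReal.ofReal p) ν) :
    |∫ z, |U z| ^ (p - 2) * U z * V z ∂ν|
      ≤ (∫ z, |U z| ^ p ∂ν) ^ (1 / Real.conjExponent p) * (∫ z, |V z| ^ p ∂ν) ^ (1 / p) := by
  refine (abs_integral_le_integral_abs).trans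
    (le_trans (le_of_eq ?_) (integral_abs_rpow_sub_one_mul_le hp hU hV))
  simp_rw [abs_mul (|U _| ^ (p - 2) * U _), abs_abs_rpow_sub_two_mul_self hp]

/-- Integrate the scalar remainder: Hölder bounds the mixed term by a small multiple of the norm `r`
of `V`, and the term `C r^p` is `o(r)` because `p > 1`. The threshold is uniform in `V`, so this is
Fréchet differentiability. -/
theorem integral_abs_rpow_remainder (hp : 1 < p) {U : α → ℝ}
    (hU : MemLp U (ENNReal.ofReal p) ν) {ε : ℝ} (hε : 0 < ε) :
    ∃ η, 0 < η ∧ ∀ V : α → ℝ, MemLp V (ENNReal.ofReal p) ν →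
      (∫ z, |V z| ^ p ∂ν) ^ (1 / p) ≤ η →
      |∫ z, |U z + V z| ^ p ∂ν - ∫ z, |U z| ^ p ∂ν - p * ∫ z, |U z| ^ (p - 2) * U z * V z ∂ν|
        ≤ ε * (∫ z, |V z| ^ p ∂ν) ^ (1 / p) := by
  set B := (∫ z, |U z| ^ p ∂ν) ^ (1 / Real.conjExponent p) with hB
  have hI0 : ∀ V : α → ℝ, 0 ≤ ∫ z, |V z| ^ p ∂ν := fun V =>
    integral_nonneg fun z => by positivity
  have hB0 : 0 ≤ B := Real.rpow_nonneg (hI0 U) _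
  obtain ⟨C, hC, h⟩ := abs_rpow_remainder hp (ε := ε / 2 / (B + 1)) (by positivity)
  -- Chosen so that `r ≤ η` forces `C r^(p-1) ≤ ε / 2`; the added `1` avoids division by zero.
  refine ⟨(ε / 2 / (C + 1)) ^ (1 / (p - 1)), by positivity, fun V hV hη => ?_⟩
  set r := (∫ z, |V z| ^ p ∂ν) ^ (1 / p) with hr
  have hr0 : 0 ≤ r := Real.rpow_nonneg (hI0 V) _
  have hrp : ∫ z, |V z| ^ p ∂ν = r ^ p := by
    rw [hr, ← Real.rpow_mul (hI0 V), one_div_mul_cancel (by linarith), Real.rpow_one]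
  have i1 := integrable_abs_rpow hp (hU.add hV)
  have i2 := integrable_abs_rpow hp hU
  have i3 := integrable_pairing hp hU hV
  have i4 := integrable_abs_rpow_sub_one_mul hp hU hV
  have i5 := integrable_abs_rpow hp hV
  simp only [Pi.add_apply] at i1
  have e1 : ∫ z, |U z + V z| ^ p ∂ν - ∫ z, |U z| ^ p ∂ν - p * ∫ z, |U z| ^ (p - 2) * U z * V z ∂ν
      = ∫ z, (|U z + V z| ^ p - |U z| ^ p - p * (|U z| ^ (p - 2) * U z * V z)) ∂ν := by
    have i12 : Integrable (fun z => |U z + V z| ^ p - |U z| ^ p) ν := i1.sub i2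
    rw [integral_sub i12 (i3.const_mul p), integral_sub i1 i2, integral_const_mul]
  rw [e1]
  have e2 : |∫ z, (|U z + V z| ^ p - |U z| ^ p - p * (|U z| ^ (p - 2) * U z * V z)) ∂ν|
      ≤ ε / 2 / (B + 1) * (B * r) + C * r ^ p := by
    calc _ ≤ ∫ z, |(|U z + V z| ^ p - |U z| ^ p - p * (|U z| ^ (p - 2) * U z * V z))| ∂ν :=
        abs_integral_le_integral_abs
      _ ≤ ∫ z, (ε / 2 / (B + 1) * (|U z| ^ (p - 1) * |V z|) + C * |V z| ^ p) ∂ν :=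
        integral_mono ((i1.sub i2).sub (i3.const_mul p)).abs
          ((i4.const_mul _).add (i5.const_mul _)) fun z => h _ _
      _ = ε / 2 / (B + 1) * ∫ z, |U z| ^ (p - 1) * |V z| ∂ν + C * r ^ p := by
        rw [integral_add (i4.const_mul _) (i5.const_mul _), integral_const_mul,
          integral_const_mul, hrp]
      _ ≤ _ := by gcongr; exact integral_abs_rpow_sub_one_mul_le hp hU hV
  refine e2.trans ?_
  have e3 : ε / 2 / (B + 1) * (B * r) ≤ ε / 2 * r := by
    rw [div_mul_eq_mul_div, div_le_iff₀ (by positivity)]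
    nlinarith [mul_nonneg hε.le hr0]
  have e4 : C * r ^ p ≤ ε / 2 * r := by
    have : r ^ (p - 1) ≤ ε / 2 / (C + 1) := by
      calc r ^ (p - 1) ≤ ((ε / 2 / (C + 1)) ^ (1 / (p - 1))) ^ (p - 1) :=
          Real.rpow_le_rpow hr0 hη (by linarith)
        _ = _ := by
          rw [← Real.rpow_mul (by positivity), one_div_mul_cancel (by linarith), Real.rpow_one]
    have e5 : r ^ p = r ^ (p - 1) * r := by
      rcases hr0.eq_or_lt with h0 | h0
      · rw [← h0, mul_zero, Real.zero_rpow (by linarith)]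
      · rw [← Real.rpow_add_one h0.ne']; ring_nf
    rw [e5, ← mul_assoc]
    gcongr
    calc C * r ^ (p - 1) ≤ C * (ε / 2 / (C + 1)) := by gcongr
      _ ≤ ε / 2 := by
        rw [mul_div_assoc', div_le_iff₀ (by positivity)]
        nlinarith
  linarith

theorem integral_abs_rpow_tangent (hp : 1 < p) {U V : α → ℝ}
    (hU : MemLp U (ENNReal.ofReal p) ν) (hV : MemLp V (ENNReal.ofReal p) ν) :
    ∫ z, |U z| ^ p ∂ν + p * ∫ z, |U z| ^ (p - 2) * U z * (V z - U z) ∂ν ≤ ∫ z, |V z| ^ p ∂ν := by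
  have i2 := integrable_abs_rpow hp hU
  have i3 := integrable_pairing hp hU (hV.sub hU)
  simp only [Pi.sub_apply] at i3
  rw [← integral_const_mul, ← integral_add i2 (i3.const_mul p)]
  exact integral_mono (i2.add (i3.const_mul p)) (integrable_abs_rpow hp hV)
    fun z => abs_rpow_tangent hp _ _

theorem memLp_comb {U V : α → ℝ} (hU : MemLp U (ENNReal.ofReal p) ν)
    (hV : MemLp V (ENNReal.ofReal p) ν) (a b : ℝ) :
    MemLp (fun z => a * U z + b * V z) (ENNReal.ofReal p) ν :=
  (hU.const_mul a).add (hV.const_mul b)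

theorem integral_abs_rpow_convex (hp : 1 < p) {U V : α → ℝ}
    (hU : MemLp U (ENNReal.ofReal p) ν) (hV : MemLp V (ENNReal.ofReal p) ν) {a b : ℝ}
    (ha : 0 < a) (hb : 0 < b) (hab : a + b = 1) :
    ∫ z, |a * U z + b * V z| ^ p ∂ν ≤ a * ∫ z, |U z| ^ p ∂ν + b * ∫ z, |V z| ^ p ∂ν := by
  have i1 := (integrable_abs_rpow hp hU).const_mul a
  have i2 := (integrable_abs_rpow hp hV).const_mul b
  rw [← integral_const_mul, ← integral_const_mul, ← integral_add i1 i2]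
  refine integral_mono (integrable_abs_rpow hp (memLp_comb hU hV a b)) (i1.add i2) fun z => ?_
  simpa using (strictConvexOn_abs_rpow hp).convexOn.2 (Set.mem_univ (U z)) (Set.mem_univ (V z))
    ha.le hb.le hab

/-- Equality would make the nonnegative pointwise convexity gap vanish almost everywhere, which
forces `U = V` almost everywhere. -/
theorem integral_abs_rpow_strictConvex (hp : 1 < p) {U V : α → ℝ}
    (hU : MemLp U (ENNReal.ofReal p) ν) (hV : MemLp V (ENNReal.ofReal p) ν) {a b : ℝ}
    (ha : 0 < a) (hb : 0 < b) (hab : a + b = 1) (hne : ¬ U =ᵐ[ν] V) :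
    ∫ z, |a * U z + b * V z| ^ p ∂ν < a * ∫ z, |U z| ^ p ∂ν + b * ∫ z, |V z| ^ p ∂ν := by
  refine (integral_abs_rpow_convex hp hU hV ha hb hab).lt_of_ne fun heq => hne ?_
  have i1 := (integrable_abs_rpow hp hU).const_mul a
  have i2 := (integrable_abs_rpow hp hV).const_mul b
  have i3 := integrable_abs_rpow hp (memLp_comb hU hV a b)
  have i12 : Integrable (fun z => a * |U z| ^ p + b * |V z| ^ p) ν := i1.add i2
  have i123 : Integrable (fun z => a * |U z| ^ p + b * |V z| ^ p - |a * U z + b * V z| ^ p) ν :=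
    i12.sub i3
  have h0 : ∫ z, (a * |U z| ^ p + b * |V z| ^ p - |a * U z + b * V z| ^ p) ∂ν = 0 := by
    rw [integral_sub i12 i3, integral_add i1 i2, integral_const_mul, integral_const_mul,
      heq, sub_self]
  rw [integral_eq_zero_iff_of_nonneg _ i123] at h0
  · filter_upwards [h0] with z hz
    by_contra hUV
    have := (strictConvexOn_abs_rpow hp).2 (Set.mem_univ (U z)) (Set.mem_univ (V z)) hUV ha hb hab
    simp only [smul_eq_mul, Pi.zero_apply] at this hz
    linarith
  · intro z
    have := (strictConvexOn_abs_rpow hp).convexOn.2 (Set.mem_univ (U z)) (Set.mem_univ (V z))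
      ha.le hb.le hab
    simp only [smul_eq_mul, Pi.zero_apply] at this ⊢
    linarith

theorem integral_abs_rpow_midpoint_gap (hp : 1 < p) {ε : ℝ} (hε : 0 < ε) :
    ∃ C, 0 ≤ C ∧ ∀ U V : α → ℝ, MemLp U (ENNReal.ofReal p) ν → MemLp V (ENNReal.ofReal p) ν →
      ∫ z, |U z - V z| ^ p ∂ν ≤ ε * (∫ z, |U z| ^ p ∂ν + ∫ z, |V z| ^ p ∂ν)
        + C * ((1 / 2) * ∫ z, |U z| ^ p ∂ν + (1 / 2) * ∫ z, |V z| ^ p ∂ν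
          - ∫ z, |(1 / 2) * U z + (1 / 2) * V z| ^ p ∂ν) := by
  obtain ⟨C, hC, h⟩ := abs_rpow_midpoint_gap hp hε
  refine ⟨C, hC, fun U V hU hV => ?_⟩
  have i1 := integrable_abs_rpow hp hU
  have i2 := integrable_abs_rpow hp hV
  have i3 := integrable_abs_rpow hp (memLp_comb hU hV (1 / 2) (1 / 2))
  have i12 : Integrable (fun z => 1 / 2 * |U z| ^ p + 1 / 2 * |V z| ^ p) ν :=
    (i1.const_mul _).add (i2.const_mul _)
  have i4 : Integrable (fun z => 1 / 2 * |U z| ^ p + 1 / 2 * |V z| ^ p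
      - |1 / 2 * U z + 1 / 2 * V z| ^ p) ν := i12.sub i3
  have i5 : Integrable (fun z => |U z| ^ p + |V z| ^ p) ν := i1.add i2
  rw [← integral_const_mul (1 / 2), ← integral_const_mul (1 / 2),
    ← integral_add (i1.const_mul _) (i2.const_mul _),
    ← integral_sub i12 i3, ← integral_add i1 i2,
    ← integral_const_mul, ← integral_const_mul, ← integral_add (i5.const_mul ε)
      (i4.const_mul C)]
  exact integral_mono (integrable_abs_rpow hp (hU.sub hV))
    ((i5.const_mul ε).add (i4.const_mul C)) fun z => h _ _

end Lp

end Peridynamic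

namespace Peridynamic

/-! ### Directional differences -/

variable {n : ℕ}

/-- The measure `|h|^{-1-sp} dx dh` on `ℝⁿ × {|h| ≤ δ}`. -/
noncomputable def kernelMeasure (n : ℕ) (s p δ : ℝ) : Measure (Pt n × ℝ) :=
  (slab n δ).withDensity fun z => ENNReal.ofReal (|z.2| ^ (1 + s * p))⁻¹

/-- The directional modulus `∫ |u(x + h eᵢ) - u(x)|ᵖ dx`. -/
noncomputable def modulus (i : Fin n) (p : ℝ) (u : Pt n → ℝ) (h : ℝ) : ENNReal :=
  ∫⁻ x, ‖u (x + h • EuclideanSpace.single i (1 : ℝ)) - u x‖ₑ ^ p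

/-- The seminorm `∫ |u(x + h eᵢ) - u(x)|ᵖ h^{-1-sp} dx dh` over all `h > 0`. -/
noncomputable def fullSeminorm (i : Fin n) (s p : ℝ) (u : Pt n → ℝ) : ENNReal :=
  ∫⁻ h in Set.Ioi (0 : ℝ), modulus i p u h * ENNReal.ofReal (|h| ^ (1 + s * p))⁻¹

theorem measurable_weight (r : ℝ) :
    Measurable fun z : Pt n × ℝ => ENNReal.ofReal (|z.2| ^ r)⁻¹ := by
  have : Measurable fun h : ℝ => |h| ^ r := by fun_prop
  exact ((this.inv).comp measurable_snd).ennreal_ofReal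

theorem measurable_shift (i : Fin n) :
    Measurable fun z : Pt n × ℝ => z.1 + z.2 • EuclideanSpace.single i (1 : ℝ) := by
  fun_prop

theorem measurable_diff (i : Fin n) {u : Pt n → ℝ} (hu : Measurable u) :
    Measurable fun z : Pt n × ℝ =>
      u (z.1 + z.2 • EuclideanSpace.single i (1 : ℝ)) - u z.1 :=
  (hu.comp (measurable_shift i)).sub (hu.comp measurable_fst)

theorem measurable_fn (u : Fn n) : Measurable (u : Pt n → ℝ) :=
  (AEEqFun.stronglyMeasurable u).measurable

theorem measurable_diffQ (i : Fin n) (u : Fn n) : Measurable (diffQ i u) :=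
  measurable_diff i (measurable_fn u)

theorem measurable_modulus (i : Fin n) (p : ℝ) {u : Pt n → ℝ} (hu : Measurable u) :
    Measurable (modulus i p u) :=
  Measurable.lintegral_prod_left' (f := fun z : Pt n × ℝ =>
    ‖u (z.1 + z.2 • EuclideanSpace.single i (1 : ℝ)) - u z.1‖ₑ ^ p)
    ((measurable_diff i hu).enorm.pow_const p)

/-- Null sets of `ℝⁿ` pull back to null sets of the slab, so `diffQ` respects almost everywhere
equality. The map is a measure-preserving shear followed by a projection. -/
theorem quasiMeasurePreserving_shift (i : Fin n) (δ : ℝ) :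
    Measure.QuasiMeasurePreserving
      (fun z : Pt n × ℝ => z.1 + z.2 • EuclideanSpace.single i (1 : ℝ)) (slab n δ) volume := by
  have h1 : MeasurePreserving
      (fun q : ℝ × Pt n => (q.1, q.2 + q.1 • EuclideanSpace.single i (1 : ℝ)))
      (((volume : Measure ℝ).restrict {h | |h| ≤ δ}).prod volume)
      (((volume : Measure ℝ).restrict {h | |h| ≤ δ}).prod volume) := by
    refine MeasurePreserving.skew_product
      (g := fun (h : ℝ) (x : Pt n) => x + h • EuclideanSpace.single i (1 : ℝ))
      (MeasurePreserving.id _) ?_ (Eventually.of_forall fun h => ?_)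
    · simp only [Function.uncurry_def]; fun_prop
    · exact (measurePreserving_add_right volume _).map_eq
  exact Measure.quasiMeasurePreserving_snd.comp
    (h1.comp Measure.measurePreserving_swap).quasiMeasurePreserving

theorem kernelMeasure_absolutelyContinuous (s p δ : ℝ) :
    kernelMeasure n s p δ ≪ slab n δ :=
  withDensity_absolutelyContinuous _ _

theorem diffQ_ae_eq (i : Fin n) (s p δ : ℝ) {u : Fn n} {g : Pt n → ℝ} (h : u =ᵐ[volume] g) :
    diffQ i u =ᵐ[kernelMeasure n s p δ]
      fun z => g (z.1 + z.2 • EuclideanSpace.single i (1 : ℝ)) - g z.1 := by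
  refine (kernelMeasure_absolutelyContinuous s p δ).ae_eq ?_
  filter_upwards [(quasiMeasurePreserving_shift i δ).ae h,
    (Measure.quasiMeasurePreserving_fst (μ := (volume : Measure (Pt n)))
      (ν := (volume : Measure ℝ).restrict {h | |h| ≤ δ})).ae h] with z h1 h2
  rw [diffQ, h1, h2]

theorem diffQ_comb_ae_eq (i : Fin n) (s p δ : ℝ) (u v : Fn n) (a b : ℝ) :
    diffQ i (a • u + b • v) =ᵐ[kernelMeasure n s p δ]
      fun z => a * diffQ i u z + b * diffQ i v z := by
  have h : (a • u + b • v : Fn n) =ᵐ[volume] fun x => a * u x + b * v x := by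
    filter_upwards [AEEqFun.coeFn_add (a • u) (b • v), AEEqFun.coeFn_smul a u,
      AEEqFun.coeFn_smul b v] with x h1 h2 h3
    simp [h1, h2, h3]
  filter_upwards [diffQ_ae_eq i s p δ h] with z hz
  rw [hz, diffQ, diffQ]; ring

theorem diffQ_add_ae_eq (i : Fin n) (s p δ : ℝ) (u v : Fn n) :
    diffQ i (u + v) =ᵐ[kernelMeasure n s p δ] fun z => diffQ i u z + diffQ i v z := by
  simpa using diffQ_comb_ae_eq i s p δ u v 1 1

theorem diffQ_sub_ae_eq (i : Fin n) (s p δ : ℝ) (u v : Fn n) :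
    diffQ i (u - v) =ᵐ[kernelMeasure n s p δ] fun z => diffQ i u z - diffQ i v z := by
  simpa [sub_eq_add_neg] using diffQ_comb_ae_eq i s p δ u v 1 (-1)

theorem ofReal_abs_rpow {p : ℝ} (hp : 0 ≤ p) (a : ℝ) :
    ENNReal.ofReal (|a| ^ p) = ‖a‖ₑ ^ p := by
  rw [Real.enorm_eq_ofReal_abs, ENNReal.ofReal_rpow_of_nonneg (abs_nonneg a) hp]

theorem gagliardo_eq (i : Fin n) (s δ : ℝ) {p : ℝ} (hp : 1 < p) (u : Fn n) :
    gagliardo i s p δ u = ∫⁻ z, ‖diffQ i u z‖ₑ ^ p ∂(kernelMeasure n s p δ) := by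
  rw [kernelMeasure, lintegral_withDensity_eq_lintegral_mul _ (measurable_weight _)
    ((measurable_diffQ i u).enorm.pow_const p), gagliardo]
  refine lintegral_congr fun z => ?_
  rw [div_eq_inv_mul, ENNReal.ofReal_mul (by positivity), ofReal_abs_rpow (by linarith)]
  rfl

theorem gagliardo_eq_lintegral_modulus (i : Fin n) (s δ : ℝ) {p : ℝ} (hp : 1 < p) (u : Fn n) :
    gagliardo i s p δ u
      = ∫⁻ h in {h | |h| ≤ δ}, modulus i p u h * ENNReal.ofReal (|h| ^ (1 + s * p))⁻¹ := by
  have hm := (measurable_diffQ i u).enorm.pow_const p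
  rw [gagliardo_eq i s δ hp u, kernelMeasure,
    lintegral_withDensity_eq_lintegral_mul _ (measurable_weight _) hm, slab,
    lintegral_prod_symm _ ((measurable_weight _).mul hm).aemeasurable]
  refine lintegral_congr fun h => ?_
  simp only [Pi.mul_apply]
  rw [lintegral_const_mul' _ _ ENNReal.ofReal_ne_top, mul_comm]
  rfl

theorem memLp_iff_lintegral_lt_top {α : Type*} [MeasurableSpace α] {ν : Measure α} {p : ℝ}
    (hp : 1 < p) {U : α → ℝ} (hU : AEStronglyMeasurable U ν) :
    MemLp U (ENNReal.ofReal p) ν ↔ ∫⁻ z, ‖U z‖ₑ ^ p ∂ν < ⊤ := by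
  have h := eLpNorm_lt_top_iff_lintegral_rpow_enorm_lt_top (f := U) (μ := ν)
    (p := ENNReal.ofReal p) (by simp; linarith) ENNReal.ofReal_ne_top
  rw [ENNReal.toReal_ofReal (by linarith)] at h
  exact ⟨fun k => h.1 k.2, fun k => ⟨hU, h.2 k⟩⟩

theorem memLp_diffQ_iff (i : Fin n) (s δ : ℝ) {p : ℝ} (hp : 1 < p) (u : Fn n) :
    MemLp (diffQ i u) (ENNReal.ofReal p) (kernelMeasure n s p δ) ↔ gagliardo i s p δ u < ⊤ := by
  rw [gagliardo_eq i s δ hp u,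
    memLp_iff_lintegral_lt_top hp (measurable_diffQ i u).aestronglyMeasurable]

theorem gagliardo_toReal (i : Fin n) (s δ : ℝ) {p : ℝ} (hp : 1 < p) (u : Fn n) :
    (gagliardo i s p δ u).toReal = ∫ z, |diffQ i u z| ^ p ∂(kernelMeasure n s p δ) := by
  rw [gagliardo_eq i s δ hp u, integral_eq_lintegral_of_nonneg_ae
    (Eventually.of_forall fun z => by positivity)
    ((measurable_diffQ i u).abs.pow_const p).aestronglyMeasurable]
  simp_rw [ofReal_abs_rpow (by linarith : 0 ≤ p)]

theorem integrable_pairingIntegrand_iff (i : Fin n) (s p δ : ℝ) (u v : Fn n) :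
    Integrable (pairingIntegrand i s p u v) (slab n δ) ↔
      Integrable (fun z => |diffQ i u z| ^ (p - 2) * diffQ i u z * diffQ i v z)
        (kernelMeasure n s p δ) := by
  rw [kernelMeasure, integrable_withDensity_iff_integrable_smul' (measurable_weight _)
    (Eventually.of_forall fun z => ENNReal.ofReal_lt_top)]
  refine integrable_congr (Eventually.of_forall fun z => ?_)
  simp only [pairingIntegrand, smul_eq_mul]
  rw [ENNReal.toReal_ofReal (by positivity), div_eq_inv_mul]

theorem integral_pairingIntegrand (i : Fin n) (s p δ : ℝ) (u v : Fn n) :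
    ∫ z, pairingIntegrand i s p u v z ∂(slab n δ)
      = ∫ z, |diffQ i u z| ^ (p - 2) * diffQ i u z * diffQ i v z ∂(kernelMeasure n s p δ) := by
  rw [kernelMeasure, integral_withDensity_eq_integral_toReal_smul (measurable_weight _)
    (Eventually.of_forall fun z => ENNReal.ofReal_lt_top)]
  refine integral_congr_ae (Eventually.of_forall fun z => ?_)
  simp only [pairingIntegrand, smul_eq_mul]
  rw [ENNReal.toReal_ofReal (by positivity), div_eq_inv_mul]

/-! ### The Poincaré inequality -/

/-- A displacement longer than the diameter bound `2R` carries every point of `Ω` outside `Ω`, where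
`u` vanishes. So `-u(x)` is a telescoping sum of `N` differences; the power-mean inequality costs
`N^(p-1)` and translation invariance makes the `N` integrals equal. -/
theorem lintegral_rpow_le_modulus (i : Fin n) {p : ℝ} (hp : 1 < p) {Ω : Set (Pt n)} {R : ℝ}
    (hR : ∀ x ∈ Ω, ‖x‖ ≤ R) {u : Pt n → ℝ} (hu : Measurable u)
    (h0 : ∀ᵐ x, x ∉ Ω → u x = 0) {N : ℕ} {h : ℝ} (hN : 2 * R < N * h) :
    ∫⁻ x, ‖u x‖ₑ ^ p ≤ (N : ENNReal) ^ p * modulus i p u h := by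
  set e : Pt n := EuclideanSpace.single i (1 : ℝ) with he
  have hne : ‖e‖ = 1 := by simp [he]
  have h1 : ∀ᵐ x, x + ((N : ℝ) * h) • e ∉ Ω → u (x + ((N : ℝ) * h) • e) = 0 :=
    (measurePreserving_add_right (volume : Measure (Pt n))
      (((N : ℝ) * h) • e)).quasiMeasurePreserving.ae h0
  have hpt : ∀ᵐ x, ‖u x‖ₑ ^ p ≤ (N : ENNReal) ^ (p - 1) *
      ∑ k ∈ Finset.range N, ‖u (x + ((k : ℝ) * h) • e + h • e) - u (x + ((k : ℝ) * h) • e)‖ₑ ^ p := by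
    filter_upwards [h0, h1] with x hx0 hx1
    by_cases hx : x ∈ Ω
    · have hx2 : u (x + ((N : ℝ) * h) • e) = 0 := by
        refine hx1 fun hmem => ?_
        have a1 := hR _ hx
        have a2 := hR _ hmem
        have a3 : ‖((N : ℝ) * h) • e‖ ≤ ‖x + ((N : ℝ) * h) • e‖ + ‖x‖ := by
          simpa using norm_sub_le (x + ((N : ℝ) * h) • e) x
        rw [norm_smul, hne, mul_one, Real.norm_eq_abs] at a3
        have := le_abs_self ((N : ℝ) * h)
        linarith
      have htel : ∑ k ∈ Finset.range N,
          (u (x + ((k : ℝ) * h) • e + h • e) - u (x + ((k : ℝ) * h) • e)) = - u x := by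
        have := Finset.sum_range_sub (fun k : ℕ => u (x + ((k : ℝ) * h) • e)) N
        simp only [hx2, Nat.cast_zero, zero_mul, zero_smul, add_zero, zero_sub] at this
        rw [← this]
        refine Finset.sum_congr rfl fun k _ => ?_
        rw [add_assoc, ← add_smul]; push_cast; ring_nf
      have h2 : ‖u x‖ₑ ≤ ∑ k ∈ Finset.range N,
          ‖u (x + ((k : ℝ) * h) • e + h • e) - u (x + ((k : ℝ) * h) • e)‖ₑ := by
        rw [← enorm_neg, ← htel]; exact enorm_sum_le _ _
      calc _ ≤ _ := ENNReal.rpow_le_rpow h2 (by linarith)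
        _ ≤ _ := ENNReal.rpow_sum_le_const_mul_sum_rpow _ _ hp.le
        _ = _ := by rw [Finset.card_range]
    · rw [hx0 hx]; simp [ENNReal.zero_rpow_of_pos (by linarith : 0 < p)]
  calc _ ≤ _ := lintegral_mono_ae hpt
    _ = (N : ENNReal) ^ (p - 1) * ∑ k ∈ Finset.range N, modulus i p u h := by
      have hm : ∀ c : Pt n, Measurable fun x => ‖u (x + c + h • e) - u (x + c)‖ₑ ^ p := fun c =>
        ((hu.comp (by fun_prop)).sub (hu.comp (by fun_prop))).enorm.pow_const p
      rw [lintegral_const_mul _ (Finset.measurable_sum _ fun k _ => hm _),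
        lintegral_finsetSum _ fun k _ => hm _]
      congr 1
      refine Finset.sum_congr rfl fun k _ => ?_
      exact lintegral_add_right_eq_self (fun y => ‖u (y + h • e) - u y‖ₑ ^ p) (((k : ℝ) * h) • e)
    _ = _ := by
      rw [Finset.sum_const, Finset.card_range, nsmul_eq_mul, ← mul_assoc]
      congr 1
      rcases Nat.eq_zero_or_pos N with rfl | hN0
      · simp [ENNReal.zero_rpow_of_pos (by linarith : 0 < p)]
      · have hN1 : (N : ENNReal) ≠ 0 := by simpa using hN0.ne'
        nth_rw 2 [← ENNReal.rpow_one (N : ENNReal)]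
        rw [← ENNReal.rpow_add _ _ hN1 (ENNReal.natCast_ne_top N)]
        congr 1; ring

theorem poincare (i : Fin n) {s p δ : ℝ} (hs : 0 < s) (hp : 1 < p) (hδ : 0 < δ) {Ω : Set (Pt n)}
    (hΩb : Bornology.IsBounded Ω) :
    ∃ C : ENNReal, C ≠ ⊤ ∧ ∀ u : Fn n, (∀ᵐ x, x ∉ Ω → u x = 0) →
      ∫⁻ x, ‖u x‖ₑ ^ p ≤ C * gagliardo i s p δ u := by
  obtain ⟨R, hR⟩ := hΩb.exists_norm_le
  -- One `N` serves every `h ≥ δ / 2`, which permits averaging over `h` in `[δ / 2, δ]`.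
  obtain ⟨N, hN⟩ := exists_nat_gt (2 * R / (δ / 2))
  rw [div_lt_iff₀ (by positivity)] at hN
  have hr : 0 < 1 + s * p := by have := mul_pos hs (by linarith : 0 < p); linarith
  -- The factor `δ^(1+sp)` compensates the kernel, which is at least its reciprocal for `0 < h ≤ δ`.
  set c : ENNReal := (N : ENNReal) ^ p * ENNReal.ofReal (δ ^ (1 + s * p)) with hc
  have hd0 : ENNReal.ofReal (δ / 2) ≠ 0 := by simpa using hδ
  refine ⟨(ENNReal.ofReal (δ / 2))⁻¹ * c, ENNReal.mul_ne_top (by simpa using hδ)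
    (ENNReal.mul_ne_top (ENNReal.rpow_ne_top_of_nonneg (by linarith) (ENNReal.natCast_ne_top N))
      ENNReal.ofReal_ne_top), fun u h0 => ?_⟩
  have hpt : ∀ h ∈ Set.Icc (δ / 2) δ, ∫⁻ x, ‖u x‖ₑ ^ p
      ≤ c * (modulus i p u h * ENNReal.ofReal (|h| ^ (1 + s * p))⁻¹) := by
    intro h hh
    have hh0 : 0 < h := by linarith [hh.1]
    have hNh : 2 * R < N * h := hN.trans_le (by gcongr; exact hh.1)
    refine (lintegral_rpow_le_modulus i hp hR (measurable_fn u) h0 hNh).trans ?_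
    have h1 : 1 ≤ ENNReal.ofReal (δ ^ (1 + s * p)) * ENNReal.ofReal (|h| ^ (1 + s * p))⁻¹ := by
      rw [← ENNReal.ofReal_mul (by positivity), ENNReal.one_le_ofReal, abs_of_pos hh0,
        ← div_eq_mul_inv, one_le_div (by positivity)]
      exact Real.rpow_le_rpow hh0.le hh.2 hr.le
    calc _ = (N : ENNReal) ^ p * modulus i p u h * 1 := (mul_one _).symm
      _ ≤ (N : ENNReal) ^ p * modulus i p u h *
          (ENNReal.ofReal (δ ^ (1 + s * p)) * ENNReal.ofReal (|h| ^ (1 + s * p))⁻¹) := by gcongr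
      _ = _ := by rw [hc]; ring
  have hsub : Set.Icc (δ / 2) δ ⊆ {h | |h| ≤ δ} := fun h hh => by
    have : 0 < h := by linarith [hh.1]
    simpa [abs_of_pos this] using hh.2
  have key : ENNReal.ofReal (δ / 2) * ∫⁻ x, ‖u x‖ₑ ^ p ≤ c * gagliardo i s p δ u := by
    calc _ = ∫⁻ _ in Set.Icc (δ / 2) δ, ∫⁻ x, ‖u x‖ₑ ^ p := by
          rw [setLIntegral_const, Real.volume_Icc, mul_comm]; congr 2; ring
      _ ≤ ∫⁻ h in Set.Icc (δ / 2) δ,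
          c * (modulus i p u h * ENNReal.ofReal (|h| ^ (1 + s * p))⁻¹) :=
        setLIntegral_mono' measurableSet_Icc hpt
      _ ≤ ∫⁻ h in {h | |h| ≤ δ}, c * (modulus i p u h * ENNReal.ofReal (|h| ^ (1 + s * p))⁻¹) :=
        lintegral_mono_set hsub
      _ = _ := by
        rw [gagliardo_eq_lintegral_modulus i s δ hp, lintegral_const_mul]
        refine (measurable_modulus i p (measurable_fn u)).mul ?_
        exact Measurable.ennreal_ofReal (by fun_prop)
  rw [mul_assoc, ← ENNReal.mul_le_iff_le_inv hd0 ENNReal.ofReal_ne_top]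
  exact key

/-! ### Passage from the horizon `δ` to all step lengths. -/

theorem modulus_le (i : Fin n) {p : ℝ} (hp : 1 < p) {u : Pt n → ℝ} (hu : Measurable u) (h : ℝ) :
    modulus i p u h ≤ 2 ^ p * ∫⁻ x, ‖u x‖ₑ ^ p := by
  set e : Pt n := EuclideanSpace.single i (1 : ℝ) with he
  have hm : Measurable fun x => ‖u x‖ₑ ^ p := hu.enorm.pow_const p
  have hm' : Measurable fun x => ‖u (x + h • e)‖ₑ ^ p :=
    hm.comp (measurable_id.add_const (h • e))
  calc modulus i p u h ≤ ∫⁻ x, (2 : ENNReal) ^ (p - 1) * (‖u (x + h • e)‖ₑ ^ p + ‖u x‖ₑ ^ p) := by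
        refine lintegral_mono fun x => ?_
        exact (ENNReal.rpow_le_rpow (enorm_sub_le) (by linarith)).trans
          (ENNReal.rpow_add_le_mul_rpow_add_rpow _ _ hp.le)
    _ = (2 : ENNReal) ^ (p - 1) * (2 * ∫⁻ x, ‖u x‖ₑ ^ p) := by
        rw [lintegral_const_mul' _ _ (ENNReal.rpow_ne_top_of_nonneg (by linarith)
            ENNReal.ofNat_ne_top), lintegral_add_left hm',
          lintegral_add_right_eq_self (fun x => ‖u x‖ₑ ^ p), two_mul]
    _ = _ := by
        rw [← mul_assoc]; congr 1
        nth_rw 2 [← ENNReal.rpow_one 2]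
        rw [← ENNReal.rpow_add _ _ two_ne_zero ENNReal.ofNat_ne_top]; ring_nf

/-- The boxes of the level set estimate may be longer than the horizon. For `h > δ` the modulus is
at most a multiple of `∫ |u|^p`, which Poincaré controls, and `h^(-1-sp)` is integrable at infinity.
-/
theorem fullSeminorm_le (i : Fin n) {s p δ : ℝ} (hs : 0 < s) (hp : 1 < p) (hδ : 0 < δ)
    {Ω : Set (Pt n)} (hΩb : Bornology.IsBounded Ω) :
    ∃ C : ENNReal, C ≠ ⊤ ∧ ∀ u : Fn n, (∀ᵐ x, x ∉ Ω → u x = 0) →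
      fullSeminorm i s p u ≤ C * gagliardo i s p δ u := by
  obtain ⟨C, hC, hP⟩ := poincare i hs hp hδ hΩb
  have hr : 0 < s * p := mul_pos hs (by linarith)
  set K : ENNReal := ∫⁻ h in Set.Ioi δ, ENNReal.ofReal (|h| ^ (1 + s * p))⁻¹ with hK
  have hKt : K ≠ ⊤ := by
    have hint := integrableOn_Ioi_rpow_of_lt (a := -(1 + s * p)) (by linarith) hδ
    have := hint.lintegral_lt_top
    refine ne_of_lt (lt_of_le_of_lt (le_of_eq ?_) this)
    refine setLIntegral_congr_fun measurableSet_Ioi fun h hh => ?_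
    have hh0 : 0 < h := hδ.trans hh
    simp only [abs_of_pos hh0, Real.rpow_neg hh0.le]
  refine ⟨1 + 2 ^ p * C * K, by
    refine ENNReal.add_ne_top.2 ⟨ENNReal.one_ne_top, ENNReal.mul_ne_top (ENNReal.mul_ne_top ?_ hC)
      hKt⟩
    exact ENNReal.rpow_ne_top_of_nonneg (by linarith) ENNReal.ofNat_ne_top, fun u h0 => ?_⟩
  have hwm : Measurable fun h : ℝ => ENNReal.ofReal (|h| ^ (1 + s * p))⁻¹ :=
    Measurable.ennreal_ofReal (by fun_prop)
  have e1 : ∫⁻ h in Set.Ioc 0 δ, modulus i p u h * ENNReal.ofReal (|h| ^ (1 + s * p))⁻¹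
      ≤ gagliardo i s p δ u := by
    rw [gagliardo_eq_lintegral_modulus i s δ hp]
    refine lintegral_mono_set fun h hh => ?_
    simpa [abs_of_pos hh.1] using hh.2
  have e2 : ∫⁻ h in Set.Ioi δ, modulus i p u h * ENNReal.ofReal (|h| ^ (1 + s * p))⁻¹
      ≤ 2 ^ p * C * K * gagliardo i s p δ u := by
    calc _ ≤ ∫⁻ h in Set.Ioi δ, (2 ^ p * (C * gagliardo i s p δ u)) *
          ENNReal.ofReal (|h| ^ (1 + s * p))⁻¹ := by
          refine lintegral_mono fun h => ?_
          gcongr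
          refine (modulus_le i hp (measurable_fn u) h).trans ?_
          gcongr
          exact hP u h0
      _ = _ := by rw [lintegral_const_mul _ hwm]; ring
  rw [fullSeminorm, ← Set.Ioc_union_Ioi_eq_Ioi hδ.le, lintegral_union measurableSet_Ioi
    (Set.Ioc_disjoint_Ioi le_rfl), add_mul, one_mul]
  exact add_le_add e1 e2

end Peridynamic

namespace Peridynamic

/-! ### Dyadic truncation -/

/-- The part of `|r|` between the levels `2ᵏ` and `2ᵏ⁺¹`. -/
noncomputable def dyadicTrunc (k : ℕ) (r : ℝ) : ℝ := min (max (|r| - 2 ^ k) 0) (2 ^ k)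

theorem continuous_dyadicTrunc (k : ℕ) : Continuous (dyadicTrunc k) := by
  unfold dyadicTrunc; fun_prop

/-- The layers stack without overlap: together they fill `|r|` between the heights `1` and `2^N`. -/
theorem sum_dyadicTrunc (N : ℕ) (r : ℝ) :
    ∑ k ∈ Finset.range N, dyadicTrunc k r = min (max (|r| - 1) 0) (2 ^ N - 1) := by
  induction N with
  | zero => simp
  | succ N ih =>
    rw [Finset.sum_range_succ, ih, dyadicTrunc, pow_succ]
    have h1 : (1 : ℝ) ≤ 2 ^ N := one_le_pow₀ one_le_two
    rcases le_total (|r|) 1 with h | h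
    · rw [max_eq_right (by linarith), max_eq_right (by linarith), min_eq_left (by linarith),
        min_eq_left (by linarith), min_eq_left (by linarith), add_zero]
    · rw [max_eq_left (by linarith : 0 ≤ |r| - 1)]
      rcases le_total (|r|) (2 ^ N) with h2 | h2
      · rw [max_eq_right (by linarith), min_eq_left (by linarith), min_eq_left (by linarith),
          min_eq_left (by linarith), add_zero]
      · rw [max_eq_left (by linarith), min_eq_right (by linarith)]
        rcases le_total (|r|) (2 ^ N * 2) with h3 | h3
        · rw [min_eq_left (by linarith), min_eq_left (by linarith)]; ring
        · rw [min_eq_right (by linarith), min_eq_right (by linarith)]; ring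

/-- Every layer is monotone in `|r|`, so all differences have one sign and sum to the difference of
a single 1-Lipschitz truncation. -/
theorem sum_abs_dyadicTrunc_sub_le (N : ℕ) (a b : ℝ) :
    ∑ k ∈ Finset.range N, |dyadicTrunc k a - dyadicTrunc k b| ≤ |a - b| := by
  wlog hab : |b| ≤ |a| generalizing a b with H
  · simpa only [abs_sub_comm] using H b a (le_of_not_ge hab)
  have h1 : ∀ k, |dyadicTrunc k a - dyadicTrunc k b| = dyadicTrunc k a - dyadicTrunc k b :=
    fun k => abs_of_nonneg (sub_nonneg.2 (by unfold dyadicTrunc; gcongr))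
  simp_rw [h1]
  rw [Finset.sum_sub_distrib, sum_dyadicTrunc, sum_dyadicTrunc]
  have h2 : |a| - |b| ≤ |a - b| := abs_sub_abs_le_abs_sub a b
  refine le_trans ?_ h2
  have h0 : (0 : ℝ) ≤ 2 ^ N - 1 := sub_nonneg.2 (one_le_pow₀ one_le_two)
  have h3 : min (max (|a| - 1) 0) (2 ^ N - 1) ≤ min (max (|b| - 1) 0) (2 ^ N - 1) + (|a| - |b|) := by
    rw [← min_add_add_right]
    refine min_le_min ?_ (by linarith)
    rw [← max_add_add_right]
    exact max_le_max (by linarith) (by linarith)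
  linarith

theorem sum_rpow_le_rpow_sum {p : ℝ} (hp : 1 ≤ p) (f : ℕ → ENNReal) (N : ℕ) :
    ∑ k ∈ Finset.range N, f k ^ p ≤ (∑ k ∈ Finset.range N, f k) ^ p := by
  induction N with
  | zero => simp
  | succ N ih =>
    rw [Finset.sum_range_succ, Finset.sum_range_succ]
    exact (add_le_add ih le_rfl).trans (ENNReal.add_rpow_le_rpow_add _ _ hp)

theorem tsum_enorm_dyadicTrunc_sub_rpow_le {p : ℝ} (hp : 1 ≤ p) (a b : ℝ) :
    ∑' k, ‖dyadicTrunc k a - dyadicTrunc k b‖ₑ ^ p ≤ ‖a - b‖ₑ ^ p := by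
  refine ENNReal.tsum_le_of_sum_range_le fun N => (sum_rpow_le_rpow_sum hp _ N).trans ?_
  refine ENNReal.rpow_le_rpow ?_ (by linarith)
  simp_rw [Real.enorm_eq_ofReal_abs]
  rw [← ENNReal.ofReal_sum_of_nonneg fun _ _ => abs_nonneg _]
  exact ENNReal.ofReal_le_ofReal (sum_abs_dyadicTrunc_sub_le N a b)

variable {n : ℕ}

/-- The gain over bounding each truncation separately: summability over the levels later upgrades a
weak-type bound to a strong one. Pointwise it is the comparison of `ℓᵖ` with `ℓ¹`. -/
theorem tsum_fullSeminorm_dyadicTrunc_le (i : Fin n) (s : ℝ) {p : ℝ} (hp : 1 ≤ p) {u : Pt n → ℝ}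
    (hu : Measurable u) :
    ∑' k, fullSeminorm i s p (fun x => dyadicTrunc k (u x)) ≤ fullSeminorm i s p u := by
  have hv : ∀ k, Measurable fun x => dyadicTrunc k (u x) := fun k =>
    (continuous_dyadicTrunc k).measurable.comp hu
  have hw : Measurable fun h : ℝ => ENNReal.ofReal (|h| ^ (1 + s * p))⁻¹ :=
    Measurable.ennreal_ofReal (by fun_prop)
  simp only [fullSeminorm]
  have hmw : ∀ k, Measurable fun h => modulus i p (fun x => dyadicTrunc k (u x)) h *
      ENNReal.ofReal (|h| ^ (1 + s * p))⁻¹ := fun k => (measurable_modulus i p (hv k)).mul hw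
  rw [← lintegral_tsum fun k => (hmw k).aemeasurable]
  refine lintegral_mono fun h => ?_
  rw [ENNReal.tsum_mul_right]
  gcongr
  simp only [modulus]
  rw [← lintegral_tsum fun k => Measurable.aemeasurable ?_]
  · exact lintegral_mono fun x => tsum_enorm_dyadicTrunc_sub_rpow_le hp _ _
  · exact (((hv k).comp (measurable_id.add_const _)).sub (hv k)).enorm.pow_const p

/-- For `|r| ≥ 1` the single level with `2^k ≤ |r| < 2^(k+1)` suffices; for `0 < |r| < 1` the first
indicator does. -/
theorem enorm_rpow_le_tsum_dyadic {q : ℝ} (hq : 0 < q) (r : ℝ) :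
    ‖r‖ₑ ^ q ≤ Set.indicator {r : ℝ | r ≠ 0} (fun _ => (1 : ENNReal)) r
      + ∑' k : ℕ, Set.indicator {r : ℝ | (2 : ℝ) ^ k ≤ |r|}
        (fun _ => ENNReal.ofReal (2 ^ ((k + 1 : ℝ) * q))) r := by
  rw [← ofReal_abs_rpow hq.le]
  rcases eq_or_ne r 0 with rfl | hr
  · simp [Real.zero_rpow hq.ne']
  rcases lt_or_ge (|r|) 1 with h | h
  · refine le_trans ?_ le_self_add
    rw [Set.indicator_of_mem (by exact hr), ENNReal.ofReal_le_one]
    exact Real.rpow_le_one (abs_nonneg _) h.le hq.le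
  · obtain ⟨k, hk1, hk2⟩ := exists_nat_pow_near h one_lt_two
    refine le_trans ?_ le_add_self
    refine le_trans ?_ (ENNReal.le_tsum k)
    rw [Set.indicator_of_mem (by exact hk1)]
    refine ENNReal.ofReal_le_ofReal ?_
    rw [Real.rpow_mul zero_le_two]
    refine Real.rpow_le_rpow (abs_nonneg _) ?_ hq.le
    exact_mod_cast hk2.le

/-! ### The level set estimate -/

/-- The vector whose first `j` coordinates are those of `h`, the others being zero. -/
noncomputable def partialShift (j : ℕ) (h : Fin n → ℝ) : Pt n :=
  WithLp.toLp 2 fun i => if i.val < j then h i else 0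

theorem partialShift_zero (h : Fin n → ℝ) : partialShift 0 h = 0 := by
  ext i; simp [partialShift]

theorem partialShift_self (h : Fin n → ℝ) : partialShift n h = WithLp.toLp 2 h := by
  ext i; simp [partialShift]

theorem partialShift_succ (j : Fin n) (h : Fin n → ℝ) :
    partialShift (j + 1) h = partialShift j h + h j • EuclideanSpace.single j (1 : ℝ) := by
  ext i
  simp only [partialShift, PiLp.add_apply, PiLp.smul_apply, PiLp.single_apply,
    smul_eq_mul, mul_ite, mul_one, mul_zero]
  rcases lt_trichotomy i.val j.val with hij | hij | hij
  · have : i ≠ j := fun e => by simp [e] at hij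
    simp [hij, this, Nat.lt_succ_of_lt hij]
  · obtain rfl := Fin.ext hij
    simp
  · have : i ≠ j := fun e => by simp [e] at hij
    simp [this, Nat.not_lt.2 hij.le, Nat.not_lt.2 (Nat.succ_le_of_lt hij)]

theorem measurable_partialShift (j : ℕ) : Measurable (partialShift (n := n) j) := by
  refine (MeasurableEquiv.toLp 2 (Fin n → ℝ)).measurable.comp (measurable_pi_lambda _ fun i => ?_)
  split_ifs
  · exact measurable_pi_apply i
  · exact measurable_const

theorem volume_setOf_add_toLp_mem (x : Pt n) {E : Set (Pt n)} (hE : MeasurableSet E) :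
    (volume : Measure (Fin n → ℝ)) {h | x + WithLp.toLp 2 h ∈ E} = volume E := by
  have h1 : MeasurePreserving (fun h : Fin n → ℝ => x + WithLp.toLp 2 h) volume volume :=
    (measurePreserving_add_left volume x).comp
      ((EuclideanSpace.volume_preserving_symm_measurableEquiv_toLp (Fin n)).symm)
  exact h1.measure_preimage hE.nullMeasurableSet

theorem lintegral_pi_eval (t : Fin n → ℝ) (j : Fin n) {g : ℝ → ENNReal} (hg : Measurable g) :
    ∫⁻ h, g (h j) ∂(Measure.pi fun l => (volume : Measure ℝ).restrict (Set.Ioo 0 (t l)))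
      = (∏ l ∈ Finset.univ.erase j, ENNReal.ofReal (t l)) * ∫⁻ r in Set.Ioo 0 (t j), g r := by
  rw [← lintegral_map hg (measurable_pi_apply j)]
  have hmap : Measure.map (fun h : Fin n → ℝ => h j)
      (Measure.pi fun l => (volume : Measure ℝ).restrict (Set.Ioo 0 (t l)))
      = (∏ l ∈ Finset.univ.erase j, (volume : Measure ℝ).restrict (Set.Ioo 0 (t l)) Set.univ) •
        (volume : Measure ℝ).restrict (Set.Ioo 0 (t j)) :=
    Measure.pi_map_eval (fun l => (volume : Measure ℝ).restrict (Set.Ioo 0 (t l))) j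
  rw [hmap, lintegral_smul_measure]
  simp

/-- On `(0, t)` the kernel is at least `t^(-1-sp)`. -/
theorem setLIntegral_modulus_le (i : Fin n) {s p t : ℝ} (hs : 0 < s) (hp : 1 < p) (ht : 0 < t)
    (v : Pt n → ℝ) :
    ∫⁻ r in Set.Ioo 0 t, modulus i p v r
      ≤ ENNReal.ofReal t * ENNReal.ofReal (t ^ (s * p)) * fullSeminorm i s p v := by
  have hr : 0 < 1 + s * p := by have := mul_pos hs (by linarith : 0 < p); linarith
  have e : ENNReal.ofReal t * ENNReal.ofReal (t ^ (s * p)) = ENNReal.ofReal (t ^ (1 + s * p)) := by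
    rw [← ENNReal.ofReal_mul ht.le, Real.rpow_add ht, Real.rpow_one]
  rw [e, fullSeminorm, ← lintegral_const_mul' _ _ ENNReal.ofReal_ne_top]
  refine le_trans (setLIntegral_mono' measurableSet_Ioo fun h hh => ?_)
    (lintegral_mono_set Set.Ioo_subset_Ioi_self)
  have h1 : 1 ≤ ENNReal.ofReal (t ^ (1 + s * p)) * ENNReal.ofReal (|h| ^ (1 + s * p))⁻¹ := by
    rw [← ENNReal.ofReal_mul (by positivity), ENNReal.one_le_ofReal, abs_of_pos hh.1,
      ← div_eq_mul_inv, one_le_div (Real.rpow_pos_of_pos hh.1 _)]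
    exact Real.rpow_le_rpow hh.1.le hh.2.le hr.le
  calc modulus i p v h = modulus i p v h * 1 := (mul_one _).symm
    _ ≤ modulus i p v h *
        (ENNReal.ofReal (t ^ (1 + s * p)) * ENNReal.ofReal (|h| ^ (1 + s * p))⁻¹) := by gcongr
    _ = _ := by ring

/-- The value drops by `c` along a coordinate path of `n` steps, so some step changes it by at least
`c / n`, and that term alone is at least `1`. -/
theorem one_le_sum_directional {p : Fin n → ℝ} (hp : ∀ i, 1 < p i) (hn : 0 < n) {v : Pt n → ℝ}
    {c : ℝ} (hc : 0 < c) {x : Pt n} {h : Fin n → ℝ} (hx : v x = c)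
    (hxh : v (x + WithLp.toLp 2 h) = 0) :
    1 ≤ ∑ j : Fin n, ENNReal.ofReal ((n / c) ^ p j) *
      ‖v (x + partialShift j h + h j • EuclideanSpace.single j (1 : ℝ))
        - v (x + partialShift j h)‖ₑ ^ p j := by
  have : Nonempty (Fin n) := ⟨⟨0, hn⟩⟩
  have hn0 : (0 : ℝ) < n := by exact_mod_cast hn
  set d : Fin n → ℝ := fun j => v (x + partialShift j h + h j • EuclideanSpace.single j (1 : ℝ))
    - v (x + partialShift j h) with hd
  have htel : ∑ j, d j = -c := by
    have h1 : ∀ j : Fin n, d j = v (x + partialShift (j + 1) h) - v (x + partialShift j h) :=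
      fun j => by simp only [hd, partialShift_succ, add_assoc]
    simp_rw [h1]
    rw [Fin.sum_univ_eq_sum_range (fun j => v (x + partialShift (j + 1) h)
      - v (x + partialShift j h)) n, Finset.sum_range_sub (fun j => v (x + partialShift j h)),
      partialShift_self, partialShift_zero, hxh, add_zero, hx, zero_sub]
  obtain ⟨j, -, hj⟩ := Finset.exists_le_of_sum_le (s := Finset.univ) (f := fun _ : Fin n => c / n)
    (g := fun j => |d j|) Finset.univ_nonempty (by
      calc ∑ _ : Fin n, c / n = c := by simp; field_simp
        _ = |∑ j, d j| := by rw [htel, abs_neg, abs_of_pos hc]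
        _ ≤ _ := Finset.abs_sum_le_sum_abs _ _)
  refine le_trans ?_ (Finset.single_le_sum (fun _ _ => zero_le) (Finset.mem_univ j))
  rw [← ofReal_abs_rpow (by linarith [hp j]), ← ENNReal.ofReal_mul (by positivity),
    ← Real.mul_rpow (by positivity) (abs_nonneg _), ENNReal.one_le_ofReal]
  refine Real.one_le_rpow ?_ (by linarith [hp j])
  calc (1 : ℝ) = n / c * (c / n) := by field_simp
    _ ≤ n / c * |d j| := by gcongr

/-- The difference in direction `eⱼ` along the coordinate path from `x` to `x + h`. -/
noncomputable def pathDiff (v : Pt n → ℝ) (j : Fin n) (x : Pt n) (h : Fin n → ℝ) : ℝ :=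
  v (x + partialShift j h + h j • EuclideanSpace.single j (1 : ℝ)) - v (x + partialShift j h)

theorem measurable_pathDiff {v : Pt n → ℝ} (hv : Measurable v) (j : Fin n) :
    Measurable fun z : Pt n × (Fin n → ℝ) => pathDiff v j z.1 z.2 := by
  have h1 : Measurable fun z : Pt n × (Fin n → ℝ) => z.1 + partialShift j z.2 :=
    measurable_fst.add ((measurable_partialShift j).comp measurable_snd)
  have h2 : Measurable fun z : Pt n × (Fin n → ℝ) =>
      z.1 + partialShift j z.2 + z.2 j • EuclideanSpace.single j (1 : ℝ) :=
    h1.add (by fun_prop)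
  exact (hv.comp h2).sub (hv.comp h1)

/-- Displacements keeping `x` inside `E` occupy measure at most `|E|`, hence at most half the box;
on the other half `one_le_sum_directional` applies. -/
theorem half_le_sum_lintegral_pathDiff {p t : Fin n → ℝ} (hp : ∀ i, 1 < p i) (hn : 0 < n)
    {v : Pt n → ℝ} (hv : Measurable v) {c : ℝ} (hc : 0 < c) {E : Set (Pt n)}
    (hE : MeasurableSet E) (hvE : ∀ x ∉ E, v x = 0)
    (hET : 2 * volume E ≤ ∏ j, ENNReal.ofReal (t j)) {x : Pt n} (hx : v x = c) :
    (∏ j, ENNReal.ofReal (t j)) / 2 ≤ ∑ j, ENNReal.ofReal ((n / c) ^ p j) *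
      ∫⁻ h, ‖pathDiff v j x h‖ₑ ^ p j
        ∂(Measure.pi fun l => (volume : Measure ℝ).restrict (Set.Ioo 0 (t l))) := by
  set ρ : Measure (Fin n → ℝ) :=
    Measure.pi fun l => (volume : Measure ℝ).restrict (Set.Ioo 0 (t l)) with hρ
  set T : ENNReal := ∏ j, ENNReal.ofReal (t j) with hT
  have hTt : T ≠ ⊤ := ENNReal.prod_ne_top fun _ _ => ENNReal.ofReal_ne_top
  have hρT : ρ Set.univ = T := by simp [hρ, hT, Measure.pi_univ]
  have hDmx : ∀ j, Measurable fun h => ‖pathDiff v j x h‖ₑ ^ p j := fun j =>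
    ((measurable_pathDiff hv j).comp (measurable_const.prodMk measurable_id)).enorm.pow_const _
  have hEm : MeasurableSet {h : Fin n → ℝ | x + WithLp.toLp 2 h ∈ E} :=
    (measurable_const.add (MeasurableEquiv.toLp 2 (Fin n → ℝ)).measurable) hE
  have h1 : ρ {h | x + WithLp.toLp 2 h ∈ E} ≤ T / 2 := by
    have hle : ρ ≤ volume := by
      rw [hρ, ← Measure.restrict_pi_pi]; exact Measure.restrict_le_self
    refine (hle _).trans ?_
    rw [volume_setOf_add_toLp_mem x hE, ENNReal.le_div_iff_mul_le (by simp) (by simp), mul_comm]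
    exact hET
  have h2 : ρ {h | x + WithLp.toLp 2 h ∈ E}ᶜ
      ≤ ∑ j, ENNReal.ofReal ((n / c) ^ p j) * ∫⁻ h, ‖pathDiff v j x h‖ₑ ^ p j ∂ρ := by
    calc _ = ∫⁻ h in {h | x + WithLp.toLp 2 h ∈ E}ᶜ, 1 ∂ρ := by simp
      _ ≤ ∫⁻ h in {h | x + WithLp.toLp 2 h ∈ E}ᶜ,
          ∑ j, ENNReal.ofReal ((n / c) ^ p j) * ‖pathDiff v j x h‖ₑ ^ p j ∂ρ :=
        setLIntegral_mono' hEm.compl fun h hh => one_le_sum_directional hp hn hc hx (hvE _ hh)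
      _ ≤ ∫⁻ h, ∑ j, ENNReal.ofReal ((n / c) ^ p j) * ‖pathDiff v j x h‖ₑ ^ p j ∂ρ :=
        setLIntegral_le_lintegral _ _
      _ = _ := by
        rw [lintegral_finsetSum _ fun j _ => (hDmx j).const_mul _]
        exact Finset.sum_congr rfl fun j _ => lintegral_const_mul _ (hDmx j)
  have h3 : T / 2 + T / 2
      ≤ T / 2 + ∑ j, ENNReal.ofReal ((n / c) ^ p j) * ∫⁻ h, ‖pathDiff v j x h‖ₑ ^ p j ∂ρ := by
    calc T / 2 + T / 2 = ρ {h | x + WithLp.toLp 2 h ∈ E} + ρ {h | x + WithLp.toLp 2 h ∈ E}ᶜ := by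
          rw [ENNReal.add_halves, ← hρT, measure_add_measure_compl hEm]
      _ ≤ _ := add_le_add h1 h2
  -- Subtraction in `ENNReal` is avoided by cancelling the finite summand `T / 2`.
  exact (ENNReal.add_le_add_iff_left (ENNReal.div_ne_top hTt two_ne_zero)).1 h3

/-- Integrating in `x` first removes the earlier steps of the path by translation invariance. What
remains depends on `h j` only, and the other sides of the box contribute their lengths. -/
theorem lintegral_lintegral_pathDiff_le (j : Fin n) {s p : ℝ} {t : Fin n → ℝ} (hs : 0 < s)
    (hp : 1 < p) (ht : ∀ i, 0 < t i) {v : Pt n → ℝ} (hv : Measurable v) :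
    ∫⁻ x, ∫⁻ h, ‖pathDiff v j x h‖ₑ ^ p
        ∂(Measure.pi fun l => (volume : Measure ℝ).restrict (Set.Ioo 0 (t l)))
      ≤ (∏ j, ENNReal.ofReal (t j)) *
        (ENNReal.ofReal (t j ^ (s * p)) * fullSeminorm j s p v) := by
  have h1 : ∀ h, ∫⁻ x, ‖pathDiff v j x h‖ₑ ^ p = modulus j p v (h j) := fun h =>
    lintegral_add_right_eq_self (fun y =>
      ‖v (y + h j • EuclideanSpace.single j (1 : ℝ)) - v y‖ₑ ^ p) (partialShift j h)
  rw [lintegral_lintegral_swap ((measurable_pathDiff hv j).enorm.pow_const p).aemeasurable]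
  simp_rw [h1]
  rw [lintegral_pi_eval t j (measurable_modulus j p hv),
    ← Finset.mul_prod_erase _ _ (Finset.mem_univ j)]
  calc _ ≤ (∏ l ∈ Finset.univ.erase j, ENNReal.ofReal (t l)) * (ENNReal.ofReal (t j) *
        ENNReal.ofReal (t j ^ (s * p)) * fullSeminorm j s p v) := by
        gcongr
        exact setLIntegral_modulus_le j hs hp (ht j) v
    _ = _ := by ring

/-- Integrate the pointwise bound over `F` and cancel the box volume `T`, which occurs on both
sides. -/
theorem volume_level_le {s p t : Fin n → ℝ} (hs : ∀ i, 0 < s i) (hp : ∀ i, 1 < p i)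
    (ht : ∀ i, 0 < t i) (hn : 0 < n) {v : Pt n → ℝ} (hv : Measurable v) {c : ℝ} (hc : 0 < c)
    {E F : Set (Pt n)} (hE : MeasurableSet E) (hF : MeasurableSet F) (hvF : ∀ x ∈ F, v x = c)
    (hvE : ∀ x ∉ E, v x = 0) (hET : 2 * volume E ≤ ∏ j, ENNReal.ofReal (t j)) :
    volume F ≤ 2 * ∑ j, ENNReal.ofReal ((n / c) ^ p j * t j ^ (s j * p j)) *
      fullSeminorm j (s j) (p j) v := by
  set T : ENNReal := ∏ j, ENNReal.ofReal (t j) with hT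
  have hTt : T ≠ ⊤ := ENNReal.prod_ne_top fun _ _ => ENNReal.ofReal_ne_top
  have hT0 : T ≠ 0 := Finset.prod_ne_zero_iff.2 fun j _ => by simpa using ht j
  set G : Fin n → Pt n → ENNReal := fun j x => ∫⁻ h, ‖pathDiff v j x h‖ₑ ^ p j
    ∂(Measure.pi fun l => (volume : Measure ℝ).restrict (Set.Ioo 0 (t l))) with hG
  have hmx : ∀ j, Measurable (G j) := fun j =>
    ((measurable_pathDiff hv j).enorm.pow_const (p j)).lintegral_prod_right'
  have hfin : T / 2 * volume F ≤ T * ∑ j, ENNReal.ofReal ((n / c) ^ p j * t j ^ (s j * p j)) *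
      fullSeminorm j (s j) (p j) v := by
    calc T / 2 * volume F = ∫⁻ _ in F, T / 2 := by rw [setLIntegral_const]
      _ ≤ ∫⁻ x in F, ∑ j, ENNReal.ofReal ((n / c) ^ p j) * G j x :=
        setLIntegral_mono' hF fun x hx =>
          half_le_sum_lintegral_pathDiff hp hn hv hc hE hvE hET (hvF x hx)
      _ ≤ ∫⁻ x, ∑ j, ENNReal.ofReal ((n / c) ^ p j) * G j x := setLIntegral_le_lintegral _ _
      _ = ∑ j, ENNReal.ofReal ((n / c) ^ p j) * ∫⁻ x, G j x := by
        rw [lintegral_finsetSum _ fun j _ => (hmx j).const_mul _]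
        exact Finset.sum_congr rfl fun j _ => lintegral_const_mul _ (hmx j)
      _ ≤ ∑ j, ENNReal.ofReal ((n / c) ^ p j) * (T * (ENNReal.ofReal (t j ^ (s j * p j)) *
          fullSeminorm j (s j) (p j) v)) :=
        Finset.sum_le_sum fun j _ => mul_le_mul_right
          (lintegral_lintegral_pathDiff_le j (hs j) (hp j) ht hv) _
      _ = _ := by
        rw [Finset.mul_sum]
        refine Finset.sum_congr rfl fun j _ => ?_
        rw [ENNReal.ofReal_mul (by positivity)]; ring
  rw [← ENNReal.mul_le_mul_iff_right hT0 hTt]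
  calc T * volume F = 2 * (T / 2 * volume F) := by
        rw [← mul_assoc, ENNReal.mul_div_cancel two_ne_zero ENNReal.ofNat_ne_top]
    _ ≤ 2 * _ := mul_le_mul_right hfin 2
    _ = _ := by rw [mul_left_comm]

end Peridynamic

namespace Peridynamic

/-! ### The Sobolev embedding into the critical Lebesgue space -/

variable {n : ℕ}

theorem exists_sublinear_bound {D m r : ℝ} (hr1 : r < 1) :
    ∃ M, 0 < M ∧ m ≤ M ∧ D * M ^ r ≤ M := by
  have h := tendsto_rpow_atTop (sub_pos.2 hr1)
  obtain ⟨M, hM1, hM2, hM3⟩ := ((h.eventually_ge_atTop D).and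
    ((eventually_ge_atTop m).and (eventually_gt_atTop 0))).exists
  refine ⟨M, hM3, hM2, ?_⟩
  calc D * M ^ r ≤ M ^ (1 - r) * M ^ r := by gcongr
    _ = M := by rw [← Real.rpow_add hM3]; simp

/-- The side of the averaging box in direction `i` at the level `2ᵏ`. -/
noncomputable def boxSide (s p : Fin n → ℝ) (q ν : ℝ) (k : ℕ) (i : Fin n) : ℝ :=
  (ν * 2 ^ (-(k : ℝ) * (q - p i))) ^ (1 / (s i * p i))

/-- The relation `hqσ` is what turns the exponent of the box volume into `-kq`, the decay expected
of the level set. -/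
theorem prod_boxSide {s p : Fin n → ℝ} (hs : ∀ i, 0 < s i) (hp : ∀ i, 1 < p i) {q ν : ℝ}
    (hqσ : q * (∑ i, 1 / (s i * p i) - 1) = ∑ i, 1 / s i) (hν : 0 < ν) (k : ℕ) :
    ∏ i, boxSide s p q ν k i = ν ^ (∑ i, 1 / (s i * p i)) * 2 ^ (-(k : ℝ) * q) := by
  have h2 : ∀ x : ℝ, (0 : ℝ) ≤ 2 ^ x := fun x => by positivity
  have hexp : ∑ i, -(k : ℝ) * (q - p i) * (1 / (s i * p i)) = -(k : ℝ) * q := by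
    have h1 : ∀ i, -(k : ℝ) * (q - p i) * (1 / (s i * p i))
        = -(k : ℝ) * q * (1 / (s i * p i)) + k * (1 / s i) := fun i => by
      have := (hs i).ne'
      have : p i ≠ 0 := by linarith [hp i]
      field_simp; ring
    simp_rw [h1]
    rw [Finset.sum_add_distrib, ← Finset.mul_sum, ← Finset.mul_sum, ← hqσ]; ring
  simp only [boxSide]
  simp_rw [Real.mul_rpow hν.le (h2 _), ← Real.rpow_mul zero_le_two]
  rw [Finset.prod_mul_distrib, ← Real.rpow_sum_of_pos hν, ← Real.rpow_sum_of_pos two_pos, hexp]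

/-- The sides are chosen so that all directions contribute at the same rate `2^(-kq)`, despite their
different orders and exponents. -/
theorem boxSide_term {s p : Fin n → ℝ} (hs : ∀ i, 0 < s i) (hp : ∀ i, 1 < p i) {q ν : ℝ}
    (hν : 0 < ν) (k : ℕ) (i : Fin n) :
    ((n : ℝ) / 2 ^ k) ^ p i * boxSide s p q ν k i ^ (s i * p i)
      = (n : ℝ) ^ p i * (ν * 2 ^ (-(k : ℝ) * q)) := by
  have h1 : s i * p i ≠ 0 := (mul_pos (hs i) (by linarith [hp i])).ne'
  rw [boxSide, ← Real.rpow_mul (by positivity), one_div_mul_cancel h1, Real.rpow_one,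
    Real.div_rpow (by positivity) (by positivity), ← Real.rpow_natCast, ← Real.rpow_mul zero_le_two]
  have h2 : (2 : ℝ) ^ (-(k : ℝ) * (q - p i)) = 2 ^ (-(k : ℝ) * q) * 2 ^ ((k : ℝ) * p i) := by
    rw [← Real.rpow_add two_pos]; ring_nf
  rw [h2]
  have : (0 : ℝ) < 2 ^ ((k : ℝ) * p i) := by positivity
  field_simp

/-- The level estimate for the `k`-th truncation, with `E` and `F` the sets at levels `2^k` and
`2^(k+1)`. Taking `ν = (2M)^(1/σ)` makes the box volume equal to twice the assumed bound on `|E|`.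
-/
theorem volume_dyadic_level_le {s p : Fin n → ℝ} (hs : ∀ i, 0 < s i) (hp : ∀ i, 1 < p i)
    (hn : 0 < n) {q M : ℝ} (hσ : 1 < ∑ i, 1 / (s i * p i))
    (hqσ : q * (∑ i, 1 / (s i * p i) - 1) = ∑ i, 1 / s i) (hM : 0 < M)
    {u : Pt n → ℝ} (hu : Measurable u) {k : ℕ}
    (hk : volume {x | (2 : ℝ) ^ k ≤ |u x|} ≤ ENNReal.ofReal (M * 2 ^ (-(k : ℝ) * q))) :
    volume {x | (2 : ℝ) ^ (k + 1) ≤ |u x|}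
      ≤ ENNReal.ofReal (2 * (∑ i, (n : ℝ) ^ p i) *
          ((2 * M) ^ (1 / ∑ i, 1 / (s i * p i)) * 2 ^ (-(k : ℝ) * q))) *
        ∑ j, fullSeminorm j (s j) (p j) fun x => dyadicTrunc k (u x) := by
  set σ := ∑ i, 1 / (s i * p i) with hσdef
  set ν := (2 * M) ^ (1 / σ) with hν
  have hν0 : 0 < ν := by positivity
  have hνσ : ν ^ σ = 2 * M := by
    rw [hν, ← Real.rpow_mul (by positivity), one_div_mul_cancel (by linarith), Real.rpow_one]
  have hc : (0 : ℝ) < 2 ^ k := by positivity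
  have hms : ∀ k : ℕ, MeasurableSet {x | (2 : ℝ) ^ k ≤ |u x|} := fun k =>
    measurableSet_le measurable_const hu.abs
  have h := volume_level_le (t := boxSide s p q ν k) hs hp
    (fun i => by unfold boxSide; positivity) hn
    ((continuous_dyadicTrunc k).measurable.comp hu) hc (hms k) (hms (k + 1))
    (fun x hx => by
      have hx' : (2 : ℝ) ^ (k + 1) ≤ |u x| := hx
      rw [pow_succ] at hx'
      simp only [Function.comp, dyadicTrunc]
      rw [max_eq_left (by linarith), min_eq_right (by linarith)])
    (fun x hx => by
      have hx' : |u x| < (2 : ℝ) ^ k := not_le.1 hx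
      simp only [Function.comp, dyadicTrunc]
      rw [max_eq_right (by linarith), min_eq_left hc.le])
    (by
      rw [← ENNReal.ofReal_prod_of_nonneg fun i _ => by unfold boxSide; positivity,
        prod_boxSide hs hp hqσ hν0, ← hσdef, hνσ, mul_assoc, ENNReal.ofReal_mul zero_le_two,
        ENNReal.ofReal_ofNat]
      gcongr)
  refine h.trans ?_
  rw [Finset.mul_sum, Finset.mul_sum]
  refine Finset.sum_le_sum fun j _ => ?_
  rw [boxSide_term hs hp hν0, ← mul_assoc, mul_assoc (2 : ℝ), ENNReal.ofReal_mul zero_le_two,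
    ENNReal.ofReal_ofNat]
  have h1 : (n : ℝ) ^ p j ≤ ∑ i, (n : ℝ) ^ p i :=
    Finset.single_le_sum (f := fun i => (n : ℝ) ^ p i) (fun i _ => by positivity)
      (Finset.mem_univ j)
  exact mul_le_mul_left (mul_le_mul_right (ENNReal.ofReal_le_ofReal
    (mul_le_mul_of_nonneg_right h1 (by positivity))) _) _

/-- An induction over levels gives `|{|u| ≥ 2^k}| ≤ M 2^(-kq)`; reinserting this in the level
estimate gains the factor `b k`, which is summable. The bound is not homogeneous in `u`; scaling is
applied afterwards in `exists_eLpNorm_le`. -/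
theorem exists_lintegral_rpow_le {s p : Fin n → ℝ} (hs : ∀ i, 0 < s i) (hp : ∀ i, 1 < p i)
    (hn : 0 < n) {q : ℝ} (hq : 0 < q) (hσ : 1 < ∑ i, 1 / (s i * p i))
    (hqσ : q * (∑ i, 1 / (s i * p i) - 1) = ∑ i, 1 / s i) (m B : ℝ) :
    ∃ K : ENNReal, K ≠ ⊤ ∧ ∀ u : Pt n → ℝ, Measurable u → volume {x | u x ≠ 0} ≤ ENNReal.ofReal m →
      ∑ j, fullSeminorm j (s j) (p j) u ≤ ENNReal.ofReal B → ∫⁻ x, ‖u x‖ₑ ^ q ≤ K := by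
  set σ := ∑ i, 1 / (s i * p i) with hσdef
  set c := ∑ i, (n : ℝ) ^ p i with hcdef
  have hc : 0 ≤ c := Finset.sum_nonneg fun i _ => by positivity
  -- The recursion returns a bound of order `M^(1/σ)` with `1/σ < 1`, so a large enough `M`
  -- reproduces itself; `m ≤ M` starts the induction.
  obtain ⟨M, hM0, hmM, hM⟩ := exists_sublinear_bound (D := 2 * c * 2 ^ (1 / σ) * B * 2 ^ q)
    (m := m) (r := 1 / σ) (by rw [div_lt_one (by linarith)]; exact hσ)
  set ν := (2 * M) ^ (1 / σ) with hν
  have hν' : ν = 2 ^ (1 / σ) * M ^ (1 / σ) := by rw [hν, Real.mul_rpow zero_le_two hM0.le]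
  refine ⟨ENNReal.ofReal m + (ENNReal.ofReal (2 ^ q) * ENNReal.ofReal m +
    ENNReal.ofReal (2 ^ (2 * q) * (2 * c * ν)) * ENNReal.ofReal B), by finiteness,
    fun u hu hum huB => ?_⟩
  set b : ℕ → ENNReal := fun k =>
    ∑ j, fullSeminorm j (s j) (p j) fun x => dyadicTrunc k (u x) with hb
  have hbsum : ∑' k, b k ≤ ENNReal.ofReal B := by
    refine le_trans ?_ huB
    rw [hb, Summable.tsum_finsetSum fun _ _ => ENNReal.summable]
    exact Finset.sum_le_sum fun j _ => tsum_fullSeminorm_dyadicTrunc_le j (s j) (hp j).le hu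
  have hbk : ∀ k, b k ≤ ENNReal.ofReal B := fun k => (ENNReal.le_tsum k).trans hbsum
  have ha0 : ∀ k : ℕ, volume {x | (2 : ℝ) ^ k ≤ |u x|} ≤ ENNReal.ofReal m := fun k => by
    refine (measure_mono fun x hx => ?_).trans hum
    have hx' : (2 : ℝ) ^ k ≤ |u x| := hx
    exact abs_pos.1 (lt_of_lt_of_le (by positivity) hx')
  have hMk : ∀ k : ℕ,
      volume {x | (2 : ℝ) ^ k ≤ |u x|} ≤ ENNReal.ofReal (M * 2 ^ (-(k : ℝ) * q)) := by
    intro k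
    induction k with
    | zero =>
      refine (ha0 0).trans (ENNReal.ofReal_le_ofReal ?_)
      simpa using hmM
    | succ k ih =>
      refine (volume_dyadic_level_le hs hp hn hσ hqσ hM0 hu ih).trans ?_
      refine (mul_le_mul_right (hbk k) _).trans ?_
      rw [← ENNReal.ofReal_mul (by positivity)]
      refine ENNReal.ofReal_le_ofReal ?_
      rw [← hσdef, ← hcdef, ← hν, hν']
      have e : (2 : ℝ) ^ (-(k : ℝ) * q) = 2 ^ (-((k + 1 : ℕ) : ℝ) * q) * 2 ^ q := by
        rw [← Real.rpow_add two_pos]; push_cast; ring_nf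
      rw [e]
      have := mul_le_mul_of_nonneg_right hM
        (by positivity : (0 : ℝ) ≤ 2 ^ (-((k + 1 : ℕ) : ℝ) * q))
      linarith
  -- The shell starting at `2^(k+1)` reaches up to `2^(k+2)`; the two extra powers produce `2^(2q)`.
  have hstep : ∀ k : ℕ, ENNReal.ofReal (2 ^ (((k + 1 : ℕ) + 1 : ℝ) * q)) *
      volume {x | (2 : ℝ) ^ (k + 1) ≤ |u x|}
        ≤ ENNReal.ofReal (2 ^ (2 * q) * (2 * c * ν)) * b k := by
    intro k
    refine (mul_le_mul_right (volume_dyadic_level_le hs hp hn hσ hqσ hM0 hu (hMk k)) _).trans ?_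
    rw [← mul_assoc, ← ENNReal.ofReal_mul (by positivity)]
    refine mul_le_mul_left (ENNReal.ofReal_le_ofReal (le_of_eq ?_)) _
    have e : (2 : ℝ) ^ (((k + 1 : ℕ) + 1 : ℝ) * q) * 2 ^ (-(k : ℝ) * q) = 2 ^ (2 * q) := by
      rw [← Real.rpow_add two_pos]; push_cast; ring_nf
    rw [← e]; ring
  have hms : ∀ k : ℕ, MeasurableSet {x | (2 : ℝ) ^ k ≤ |u x|} := fun k =>
    measurableSet_le measurable_const hu.abs
  have hm0 : MeasurableSet {x | u x ≠ 0} := (measurableSet_eq_fun hu measurable_const).compl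
  calc ∫⁻ x, ‖u x‖ₑ ^ q
      ≤ ∫⁻ x, (Set.indicator {x | u x ≠ 0} (fun _ => (1 : ENNReal)) x
        + ∑' k : ℕ, Set.indicator {x | (2 : ℝ) ^ k ≤ |u x|}
          (fun _ => ENNReal.ofReal (2 ^ ((k + 1 : ℝ) * q))) x) :=
        lintegral_mono fun x => enorm_rpow_le_tsum_dyadic hq (u x)
    _ = volume {x | u x ≠ 0} + ∑' k : ℕ, ENNReal.ofReal (2 ^ ((k + 1 : ℝ) * q)) *
        volume {x | (2 : ℝ) ^ k ≤ |u x|} := by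
        rw [lintegral_add_left (measurable_const.indicator hm0), lintegral_indicator_const hm0,
          one_mul, lintegral_tsum fun k => (measurable_const.indicator (hms k)).aemeasurable]
        simp_rw [lintegral_indicator_const (hms _)]
    _ = volume {x | u x ≠ 0} + (ENNReal.ofReal (2 ^ q) * volume {x | (2 : ℝ) ^ 0 ≤ |u x|} +
        ∑' k : ℕ, ENNReal.ofReal (2 ^ (((k + 1 : ℕ) + 1 : ℝ) * q)) *
        volume {x | (2 : ℝ) ^ (k + 1) ≤ |u x|}) := by
        rw [tsum_eq_zero_add' ENNReal.summable]
        norm_num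
    _ ≤ _ := by
        gcongr
        · exact ha0 0
        · refine (ENNReal.tsum_le_tsum hstep).trans ?_
          rw [ENNReal.tsum_mul_left]
          gcongr

end Peridynamic

namespace Peridynamic

/-! ### The space `W₀` -/

variable {n : ℕ}

/-- The standing assumptions on the orders, exponents, horizons and the domain. -/
structure Admissible (s p δ : Fin n → ℝ) (Ω : Set (Pt n)) : Prop where
  dim_pos : 0 < n
  order_pos : ∀ i, 0 < s i
  one_lt : ∀ i, 1 < p i
  horizon_pos : ∀ i, 0 < δ i
  bounded : Bornology.IsBounded Ω

/-- The directional seminorm raised to the power `pᵢ`, as a real number. -/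
noncomputable def semi (s p δ : Fin n → ℝ) (i : Fin n) (u : Fn n) : ℝ :=
  (gagliardo i (s i) (p i) (δ i) u).toReal

variable {s p δ w : Fin n → ℝ} {Ω : Set (Pt n)} {u v : Fn n}

theorem semi_nonneg (i : Fin n) (u : Fn n) : 0 ≤ semi s p δ i u := ENNReal.toReal_nonneg

theorem semi_eq_integral (H : Admissible s p δ Ω) (i : Fin n) (u : Fn n) :
    semi s p δ i u = ∫ z, |diffQ i u z| ^ p i ∂(kernelMeasure n (s i) (p i) (δ i)) :=
  gagliardo_toReal i _ _ (H.one_lt i) u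

/-- Poincaré makes the `L^{pᵢ}` conditions automatic, so only seminorms need checking later. -/
theorem mem_W0_iff (H : Admissible s p δ Ω) :
    u ∈ W0 s p δ Ω ↔
      (∀ i, gagliardo i (s i) (p i) (δ i) u < ⊤) ∧ ∀ᵐ x, x ∉ Ω → u x = 0 := by
  refine ⟨fun h => ⟨fun i => (h.1 i).2, h.2⟩, fun h => ⟨fun i => ⟨?_, h.1 i⟩, h.2⟩⟩
  obtain ⟨C, hC, hP⟩ := poincare i (H.order_pos i) (H.one_lt i) (H.horizon_pos i) H.bounded
  rw [memLp_iff_lintegral_lt_top (H.one_lt i) (measurable_fn u).aestronglyMeasurable]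
  exact (hP u h.2).trans_lt (ENNReal.mul_lt_top hC.lt_top (h.1 i))

theorem memLp_diffQ_of_mem (H : Admissible s p δ Ω) (hu : u ∈ W0 s p δ Ω) (i : Fin n) :
    MemLp (diffQ i u) (ENNReal.ofReal (p i)) (kernelMeasure n (s i) (p i) (δ i)) :=
  (memLp_diffQ_iff i _ _ (H.one_lt i) u).2 (hu.1 i).2

theorem coeFn_comb (a b : ℝ) (u v : Fn n) :
    (a • u + b • v : Fn n) =ᵐ[volume] fun x => a * u x + b * v x := by
  filter_upwards [AEEqFun.coeFn_add (a • u) (b • v), AEEqFun.coeFn_smul a u,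
    AEEqFun.coeFn_smul b v] with x h1 h2 h3
  simp [h1, h2, h3]

theorem comb_mem_W0 (H : Admissible s p δ Ω) (hu : u ∈ W0 s p δ Ω) (hv : v ∈ W0 s p δ Ω)
    (a b : ℝ) : a • u + b • v ∈ W0 s p δ Ω := by
  rw [mem_W0_iff H]
  refine ⟨fun i => ?_, ?_⟩
  · rw [← memLp_diffQ_iff i _ _ (H.one_lt i)]
    exact (memLp_congr_ae (diffQ_comb_ae_eq i _ _ _ u v a b)).2
      (memLp_comb (memLp_diffQ_of_mem H hu i) (memLp_diffQ_of_mem H hv i) a b)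
  · filter_upwards [hu.2, hv.2, coeFn_comb a b u v] with x h1 h2 h3 hx
    rw [h3, h1 hx, h2 hx]; simp

theorem add_mem_W0 (H : Admissible s p δ Ω) (hu : u ∈ W0 s p δ Ω) (hv : v ∈ W0 s p δ Ω) :
    u + v ∈ W0 s p δ Ω := by
  simpa using comb_mem_W0 H hu hv 1 1

theorem sub_mem_W0 (H : Admissible s p δ Ω) (hu : u ∈ W0 s p δ Ω) (hv : v ∈ W0 s p δ Ω) :
    u - v ∈ W0 s p δ Ω := by
  simpa [sub_eq_add_neg] using comb_mem_W0 H hu hv 1 (-1)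

theorem smul_mem_W0 (H : Admissible s p δ Ω) (hu : u ∈ W0 s p δ Ω) (a : ℝ) :
    a • u ∈ W0 s p δ Ω := by
  simpa using comb_mem_W0 H hu hu a 0

theorem zero_mem_W0 (H : Admissible s p δ Ω) : (0 : Fn n) ∈ W0 s p δ Ω := by
  have h0 : ((0 : Fn n) : Pt n → ℝ) =ᵐ[volume] 0 := AEEqFun.coeFn_zero
  rw [mem_W0_iff H]
  refine ⟨fun i => ?_, by filter_upwards [h0] with x hx _ using hx⟩
  rw [← memLp_diffQ_iff i _ _ (H.one_lt i)]
  refine (memLp_congr_ae (diffQ_ae_eq i _ _ _ h0)).2 ?_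
  simp

theorem semi_add_eq (H : Admissible s p δ Ω) (i : Fin n) (u v : Fn n) :
    semi s p δ i (u + v) = ∫ z, |diffQ i u z + diffQ i v z| ^ p i
      ∂(kernelMeasure n (s i) (p i) (δ i)) := by
  rw [semi_eq_integral H]
  refine integral_congr_ae ?_
  filter_upwards [diffQ_add_ae_eq i (s i) (p i) (δ i) u v] with z hz
  rw [hz]

theorem semi_sub_eq (H : Admissible s p δ Ω) (i : Fin n) (u v : Fn n) :
    semi s p δ i (u - v) = ∫ z, |diffQ i u z - diffQ i v z| ^ p i
      ∂(kernelMeasure n (s i) (p i) (δ i)) := by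
  rw [semi_eq_integral H]
  refine integral_congr_ae ?_
  filter_upwards [diffQ_sub_ae_eq i (s i) (p i) (δ i) u v] with z hz
  rw [hz]

theorem semi_comb_eq (H : Admissible s p δ Ω) (i : Fin n) (u v : Fn n) (a b : ℝ) :
    semi s p δ i (a • u + b • v) = ∫ z, |a * diffQ i u z + b * diffQ i v z| ^ p i
      ∂(kernelMeasure n (s i) (p i) (δ i)) := by
  rw [semi_eq_integral H]
  refine integral_congr_ae ?_
  filter_upwards [diffQ_comb_ae_eq i (s i) (p i) (δ i) u v a b] with z hz
  rw [hz]

theorem gagliardo_smul (H : Admissible s p δ Ω) (i : Fin n) (a : ℝ) (u : Fn n) :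
    gagliardo i (s i) (p i) (δ i) (a • u) = ‖a‖ₑ ^ p i * gagliardo i (s i) (p i) (δ i) u := by
  have hp0 : 0 ≤ p i := by linarith [H.one_lt i]
  rw [gagliardo_eq i _ _ (H.one_lt i), gagliardo_eq i _ _ (H.one_lt i),
    ← lintegral_const_mul _ ((measurable_diffQ i u).enorm.pow_const _)]
  refine lintegral_congr_ae ?_
  have h := diffQ_comb_ae_eq i (s i) (p i) (δ i) u 0 a 0
  simp only [smul_zero, add_zero, zero_mul] at h
  filter_upwards [h] with z hz
  rw [hz, enorm_mul, ENNReal.mul_rpow_of_nonneg _ _ hp0]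

theorem wNorm_nonneg (u : Fn n) : 0 ≤ wNorm s p δ u :=
  Finset.sum_nonneg fun i _ => by positivity

theorem wNorm_smul (H : Admissible s p δ Ω) (a : ℝ) (u : Fn n) :
    wNorm s p δ (a • u) = |a| * wNorm s p δ u := by
  rw [wNorm, wNorm, Finset.mul_sum]
  refine Finset.sum_congr rfl fun i _ => ?_
  have hp0 : 0 < p i := by linarith [H.one_lt i]
  rw [gagliardo_smul H, eLpNorm_congr_ae (AEEqFun.coeFn_smul a u), eLpNorm_const_smul,
    ENNReal.toReal_mul, ENNReal.toReal_mul, mul_add, ← ENNReal.toReal_rpow, toReal_enorm,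
    Real.norm_eq_abs, Real.mul_rpow (by positivity) ENNReal.toReal_nonneg,
    ← Real.rpow_mul (abs_nonneg a), mul_one_div_cancel hp0.ne', Real.rpow_one]

theorem semi_rpow_le_wNorm (i : Fin n) (u : Fn n) :
    semi s p δ i u ^ (1 / p i) ≤ wNorm s p δ u := by
  have h := Finset.single_le_sum (f := fun i => (gagliardo i (s i) (p i) (δ i) u).toReal ^ (1 / p i)
    + (eLpNorm u (ENNReal.ofReal (p i)) volume).toReal) (fun j _ => by positivity)
    (Finset.mem_univ i)
  exact le_trans (le_add_of_nonneg_right ENNReal.toReal_nonneg) h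

theorem semi_le_wNorm_rpow (H : Admissible s p δ Ω) (i : Fin n) (u : Fn n) :
    semi s p δ i u ≤ wNorm s p δ u ^ p i := by
  have hp0 : 0 < p i := by linarith [H.one_lt i]
  calc semi s p δ i u = (semi s p δ i u ^ (1 / p i)) ^ p i := by
        rw [← Real.rpow_mul (semi_nonneg i u), one_div_mul_cancel hp0.ne', Real.rpow_one]
    _ ≤ _ := Real.rpow_le_rpow (Real.rpow_nonneg (semi_nonneg i u) _) (semi_rpow_le_wNorm i u) hp0.le

/-- By Poincaré the seminorms alone give an equivalent norm on `W₀`. -/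
theorem exists_wNorm_le (H : Admissible s p δ Ω) :
    ∃ C : ℝ, 0 ≤ C ∧ ∀ u ∈ W0 s p δ Ω, wNorm s p δ u ≤ C * ∑ i, semi s p δ i u ^ (1 / p i) := by
  choose C hC hP using fun i =>
    poincare i (H.order_pos i) (H.one_lt i) (H.horizon_pos i) H.bounded
  refine ⟨∑ i, (1 + (C i).toReal ^ (1 / p i)),
    Finset.sum_nonneg fun i _ => by positivity, fun u hu => ?_⟩
  rw [wNorm, Finset.mul_sum]
  refine Finset.sum_le_sum fun i _ => ?_
  have hp0 : 0 < p i := by linarith [H.one_lt i]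
  have h1 : (eLpNorm u (ENNReal.ofReal (p i)) volume).toReal
      ≤ (C i).toReal ^ (1 / p i) * semi s p δ i u ^ (1 / p i) := by
    rw [eLpNorm_eq_lintegral_rpow_enorm_toReal (by simpa using hp0) ENNReal.ofReal_ne_top,
      ENNReal.toReal_ofReal hp0.le, ← Real.mul_rpow ENNReal.toReal_nonneg (semi_nonneg i u), semi,
      ← ENNReal.toReal_mul, ENNReal.toReal_rpow]
    refine ENNReal.toReal_mono ?_ (ENNReal.rpow_le_rpow (hP i u hu.2) (by positivity))
    exact ENNReal.rpow_ne_top_of_nonneg (by positivity) (ENNReal.mul_ne_top (hC i) (hu.1 i).2.ne)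
  have h2 : 1 + (C i).toReal ^ (1 / p i) ≤ ∑ i, (1 + (C i).toReal ^ (1 / p i)) :=
    Finset.single_le_sum (f := fun i => 1 + (C i).toReal ^ (1 / p i))
      (fun j _ => by positivity) (Finset.mem_univ i)
  have h3 : 0 ≤ semi s p δ i u ^ (1 / p i) := Real.rpow_nonneg (semi_nonneg i u) _
  calc _ ≤ semi s p δ i u ^ (1 / p i) + (C i).toReal ^ (1 / p i) * semi s p δ i u ^ (1 / p i) :=
        add_le_add le_rfl h1
    _ = (1 + (C i).toReal ^ (1 / p i)) * semi s p δ i u ^ (1 / p i) := by ring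
    _ ≤ _ := by gcongr

theorem eq_zero_of_semi_eq_zero (H : Admissible s p δ Ω) (hu : u ∈ W0 s p δ Ω) (i : Fin n)
    (h : semi s p δ i u = 0) : u = 0 := by
  obtain ⟨C, hC, hP⟩ := poincare i (H.order_pos i) (H.one_lt i) (H.horizon_pos i) H.bounded
  have hp0 : 0 < p i := by linarith [H.one_lt i]
  have h0 : gagliardo i (s i) (p i) (δ i) u = 0 :=
    ((ENNReal.toReal_eq_zero_iff _).1 h).resolve_right (hu.1 i).2.ne
  have h1 := hP u hu.2
  rw [h0, mul_zero, nonpos_iff_eq_zero,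
    lintegral_eq_zero_iff ((measurable_fn u).enorm.pow_const _)] at h1
  refine AEEqFun.ext ?_
  filter_upwards [h1, AEEqFun.coeFn_zero (α := Pt n) (β := ℝ) (μ := volume)] with x hx h0x
  rw [h0x]
  simpa [ENNReal.rpow_eq_zero_iff, hp0, hp0.not_gt] using hx

/-- Fatou's lemma on the slab: almost everywhere convergence on `ℝⁿ` passes to the differences
through `quasiMeasurePreserving_shift`. -/
theorem gagliardo_le_of_ae_tendsto (H : Admissible s p δ Ω) (i : Fin n) {g : ℕ → Fn n}
    (hg : ∀ᵐ x, Tendsto (fun k => g k x) atTop (𝓝 (u x))) {c : ENNReal}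
    (hc : ∀ᶠ k in atTop, gagliardo i (s i) (p i) (δ i) (g k) ≤ c) :
    gagliardo i (s i) (p i) (δ i) u ≤ c := by
  have hD : ∀ᵐ z ∂(kernelMeasure n (s i) (p i) (δ i)),
      Tendsto (fun k => diffQ i (g k) z) atTop (𝓝 (diffQ i u z)) := by
    refine (kernelMeasure_absolutelyContinuous _ _ _).ae_le ?_
    filter_upwards [(quasiMeasurePreserving_shift i (δ i)).ae hg,
      (Measure.quasiMeasurePreserving_fst (μ := (volume : Measure (Pt n)))
        (ν := (volume : Measure ℝ).restrict {h | |h| ≤ δ i})).ae hg] with z h1 h2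
    exact h1.sub h2
  rw [gagliardo_eq i _ _ (H.one_lt i)]
  calc _ = ∫⁻ z, liminf (fun k => ‖diffQ i (g k) z‖ₑ ^ p i) atTop
        ∂(kernelMeasure n (s i) (p i) (δ i)) := by
        refine lintegral_congr_ae ?_
        filter_upwards [hD] with z hz
        exact (((ENNReal.continuous_rpow_const.tendsto _).comp hz.enorm).liminf_eq).symm
    _ ≤ _ := lintegral_liminf_le fun k => (measurable_diffQ i (g k)).enorm.pow_const _
    _ ≤ c := by
        refine liminf_le_of_frequently_le' (Eventually.frequently ?_)
        filter_upwards [hc] with k hk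
        rwa [← gagliardo_eq i _ _ (H.one_lt i)]

/-! ### Exponents and the embedding -/

/-- With `σ = ∑ 1/(sᵢpᵢ)` and `τ = ∑ 1/sᵢ` the two means are `n/σ` and `n/τ`, so the critical
exponent is `τ/(σ-1)` and subcriticality means `σ > 1`. -/
theorem criticalExponent_spec (hn : 0 < n) (hs : ∀ i, 0 < s i) (hp : ∀ i, 1 < p i)
    (hsp : meanSP s p < n) :
    1 < ∑ i, 1 / (s i * p i) ∧
      criticalExponent s p * (∑ i, 1 / (s i * p i) - 1) = ∑ i, 1 / s i := by
  have : Nonempty (Fin n) := ⟨⟨0, hn⟩⟩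
  have hn0 : (0 : ℝ) < n := by exact_mod_cast hn
  have hsp0 : ∀ i, 0 < s i * p i := fun i => mul_pos (hs i) (by linarith [hp i])
  set σ := ∑ i, 1 / (s i * p i) with hσ
  set τ := ∑ i, 1 / s i with hτ
  have hσ0 : 0 < σ :=
    Finset.sum_pos (fun i _ => one_div_pos.2 (hsp0 i)) Finset.univ_nonempty
  have hτ0 : 0 < τ :=
    Finset.sum_pos (fun i _ => one_div_pos.2 (hs i)) Finset.univ_nonempty
  have e1 : meanSP s p = n / σ := by
    rw [meanSP, harmonicMean, ← hσ]; field_simp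
  have e2 : harmonicMean s = n / τ := by
    rw [harmonicMean, ← hτ]; field_simp
  have h1 : 1 < σ := by
    rw [e1, div_lt_iff₀ hσ0] at hsp
    nlinarith
  refine ⟨h1, ?_⟩
  rw [criticalExponent, e1, e2]
  have h2 : σ - 1 ≠ 0 := by linarith
  have h3 : (n : ℝ) - n / σ ≠ 0 := by
    rw [e1] at hsp; linarith
  have h4 : (n : ℝ) - n / σ = n * (σ - 1) / σ := by field_simp
  rw [h4]; field_simp

theorem exists_eLpNorm_le (H : Admissible s p δ Ω) {q : ℝ} (hq : 0 < q)
    (hσ : 1 < ∑ i, 1 / (s i * p i))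
    (hqσ : q * (∑ i, 1 / (s i * p i) - 1) = ∑ i, 1 / s i) :
    ∃ C : ENNReal, C ≠ ⊤ ∧ ∀ u ∈ W0 s p δ Ω,
      eLpNorm u (ENNReal.ofReal q) volume ≤ C * ENNReal.ofReal (wNorm s p δ u) := by
  choose C hC hF using fun i =>
    fullSeminorm_le i (H.order_pos i) (H.one_lt i) (H.horizon_pos i) H.bounded
  have hqe : ∀ u : Fn n, eLpNorm u (ENNReal.ofReal q) volume
      = (∫⁻ x, ‖u x‖ₑ ^ q) ^ (1 / q) := fun u => by
    rw [eLpNorm_eq_lintegral_rpow_enorm_toReal (by simpa using hq) ENNReal.ofReal_ne_top,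
      ENNReal.toReal_ofReal hq.le]
  obtain ⟨K, hK, hKu⟩ := exists_lintegral_rpow_le H.order_pos H.one_lt H.dim_pos hq hσ hqσ
    (volume Ω).toReal (∑ i, C i).toReal
  refine ⟨K ^ (1 / q), ENNReal.rpow_ne_top_of_nonneg (by positivity) hK, fun u hu => ?_⟩
  -- Normalization to norm `1` needs a nonzero norm; when the norm is zero, a vanishing seminorm
  -- already forces `u = 0`.
  rcases (wNorm_nonneg (s := s) (p := p) (δ := δ) u).eq_or_lt with h0 | h0
  · have hi : semi s p δ ⟨0, H.dim_pos⟩ u = 0 := by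
      have := semi_le_wNorm_rpow H ⟨0, H.dim_pos⟩ u
      rw [← h0, Real.zero_rpow (by linarith [H.one_lt ⟨0, H.dim_pos⟩])] at this
      exact le_antisymm this (semi_nonneg _ u)
    rw [eq_zero_of_semi_eq_zero H hu _ hi, eLpNorm_congr_ae AEEqFun.coeFn_zero]
    simp
  · set r := wNorm s p δ u with hr
    have hv : r⁻¹ • u ∈ W0 s p δ Ω := smul_mem_W0 H hu _
    have hg : ∀ i, gagliardo i (s i) (p i) (δ i) (r⁻¹ • u) ≤ 1 := fun i => by
      have hp0 : 0 < p i := by linarith [H.one_lt i]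
      have h1 := semi_le_wNorm_rpow H i (r⁻¹ • u)
      rw [wNorm_smul H, ← hr, abs_of_pos (inv_pos.2 h0), inv_mul_cancel₀ h0.ne',
        Real.one_rpow] at h1
      rw [← ENNReal.ofReal_toReal (hv.1 i).2.ne]
      exact ENNReal.ofReal_le_one.2 h1
    have h1 := hKu (r⁻¹ • u : Fn n) (measurable_fn _) (by
      rw [ENNReal.ofReal_toReal H.bounded.measure_lt_top.ne]
      refine measure_mono_ae ?_
      filter_upwards [hv.2] with x hx hx0
      by_contra hxΩ
      exact hx0 (hx hxΩ)) (by
      rw [ENNReal.ofReal_toReal (ENNReal.sum_ne_top.2 fun i _ => hC i)]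
      refine Finset.sum_le_sum fun i _ => (hF i _ hv.2).trans ?_
      exact (mul_le_mul_right (hg i) _).trans_eq (mul_one _))
    have hur : u = r • (r⁻¹ • u) := by rw [smul_smul, mul_inv_cancel₀ h0.ne', one_smul]
    calc eLpNorm u (ENNReal.ofReal q) volume
        = eLpNorm (r • (r⁻¹ • u) : Fn n) (ENNReal.ofReal q) volume := by rw [← hur]
      _ = ENNReal.ofReal r * (∫⁻ x, ‖(r⁻¹ • u : Fn n) x‖ₑ ^ q) ^ (1 / q) := by
        rw [eLpNorm_congr_ae (AEEqFun.coeFn_smul r _), eLpNorm_const_smul, hqe,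
          Real.enorm_eq_ofReal h0.le]
      _ ≤ ENNReal.ofReal r * K ^ (1 / q) := by gcongr
      _ = _ := mul_comm _ _

theorem abs_integral_mul_le {α : Type*} [MeasurableSpace α] {μ : Measure α} {a b : ENNReal}
    [ENNReal.HolderConjugate a b] {f g : α → ℝ} (hf : MemLp f a μ) (hg : MemLp g b μ) :
    |∫ x, f x * g x ∂μ| ≤ (eLpNorm f a μ * eLpNorm g b μ).toReal := by
  have hint : Integrable (fun x => f x * g x) μ := MemLp.integrable_mul hf hg
  have h1 : eLpNorm (f • g) 1 μ ≤ eLpNorm f a μ * eLpNorm g b μ :=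
    eLpNorm_smul_le_mul_eLpNorm hg.1 hf.1
  have h2 : |∫ x, f x * g x ∂μ| ≤ (eLpNorm (f • g) 1 μ).toReal := by
    rw [eLpNorm_one_eq_lintegral_enorm]
    refine (norm_integral_le_integral_norm fun x => f x * g x).trans_eq ?_
    rw [integral_norm_eq_lintegral_enorm hint.1]
    rfl
  exact h2.trans (ENNReal.toReal_mono (ENNReal.mul_ne_top hf.2.ne hg.2.ne) h1)

/-- Hölder's inequality between `f` and the critical Sobolev embedding of `v`. -/
theorem exists_linear_bound (H : Admissible s p δ Ω) (hsp : meanSP s p < n)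
    (hq : 1 < criticalExponent s p) {f : Pt n → ℝ}
    (hf : MemLp f (ENNReal.ofReal (Real.conjExponent (criticalExponent s p)))
      (volume.restrict Ω)) :
    ∃ C : ℝ, 0 ≤ C ∧ ∀ v ∈ W0 s p δ Ω, IntegrableOn (fun x => f x * v x) Ω volume ∧
      |∫ x in Ω, f x * v x| ≤ C * wNorm s p δ v := by
  obtain ⟨hσ, hqσ⟩ := criticalExponent_spec H.dim_pos H.order_pos H.one_lt hsp
  set q := criticalExponent s p with hqdef
  obtain ⟨C, hC, hCu⟩ := exists_eLpNorm_le H (by linarith) hσ hqσ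
  have hconj : ENNReal.HolderConjugate (ENNReal.ofReal (Real.conjExponent q)) (ENNReal.ofReal q) :=
    (Real.HolderConjugate.conjExponent hq).symm.ennrealOfReal
  set A := eLpNorm f (ENNReal.ofReal (Real.conjExponent q)) (volume.restrict Ω) with hA
  refine ⟨(A * C).toReal, ENNReal.toReal_nonneg, fun v hv => ?_⟩
  have hvq : eLpNorm v (ENNReal.ofReal q) (volume.restrict Ω)
      ≤ C * ENNReal.ofReal (wNorm s p δ v) :=
    (eLpNorm_mono_measure _ Measure.restrict_le_self).trans (hCu v hv)
  have hvm : MemLp v (ENNReal.ofReal q) (volume.restrict Ω) :=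
    ⟨(measurable_fn v).aestronglyMeasurable,
      hvq.trans_lt (ENNReal.mul_lt_top hC.lt_top ENNReal.ofReal_lt_top)⟩
  refine ⟨MemLp.integrable_mul hf hvm, ?_⟩
  refine (abs_integral_mul_le hf hvm).trans ?_
  rw [← ENNReal.toReal_ofReal (wNorm_nonneg (s := s) (p := p) (δ := δ) v), ← ENNReal.toReal_mul,
    mul_assoc]
  exact ENNReal.toReal_mono (ENNReal.mul_ne_top hf.2.ne
    (ENNReal.mul_ne_top hC ENNReal.ofReal_ne_top)) (mul_le_mul_right hvq A)

end Peridynamic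

namespace Peridynamic

/-! ### The energy and its derivative -/

variable {n : ℕ} {s p δ w : Fin n → ℝ} {Ω : Set (Pt n)} {f : Pt n → ℝ} {u v : Fn n}

/-- The coefficient `wᵢ δᵢ^{-pᵢ(1-sᵢ)}` of the `i`-th seminorm in the energy. -/
noncomputable def coef (w s p δ : Fin n → ℝ) (i : Fin n) : ℝ :=
  w i * (1 / δ i ^ (p i * (1 - s i)))

/-- The pairing `∫∫ |Dᵢu|^{p-2} Dᵢu Dᵢv / |h|^{1+sp}`. -/
noncomputable def pairing (s p δ : Fin n → ℝ) (i : Fin n) (u v : Fn n) : ℝ :=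
  ∫ z, |diffQ i u z| ^ (p i - 2) * diffQ i u z * diffQ i v z
    ∂(kernelMeasure n (s i) (p i) (δ i))

theorem coef_pos (H : Admissible s p δ Ω) (hw : ∀ i, 0 < w i) (i : Fin n) :
    0 < coef w s p δ i :=
  mul_pos (hw i) (one_div_pos.2 (Real.rpow_pos_of_pos (H.horizon_pos i) _))

theorem energy_eq (u : Fn n) : energy w s p δ u = ∑ i, coef w s p δ i * semi s p δ i u := by
  simp only [energy, dirEnergy, coef, semi, mul_assoc]

theorem pLaplacian_eq (u v : Fn n) :
    pLaplacian w s p δ u v = ∑ i, coef w s p δ i * (p i * pairing s p δ i u v) := by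
  simp only [pLaplacian, dirPairing, integral_pairingIntegrand, coef, pairing]
  exact Finset.sum_congr rfl fun i _ => by ring

theorem pairing_comb (H : Admissible s p δ Ω) (i : Fin n) {v₁ v₂ : Fn n} (hu : u ∈ W0 s p δ Ω)
    (h₁ : v₁ ∈ W0 s p δ Ω) (h₂ : v₂ ∈ W0 s p δ Ω) (a b : ℝ) :
    pairing s p δ i u (a • v₁ + b • v₂)
      = a * pairing s p δ i u v₁ + b * pairing s p δ i u v₂ := by
  have i1 := integrable_pairing (H.one_lt i) (memLp_diffQ_of_mem H hu i)
    (memLp_diffQ_of_mem H h₁ i)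
  have i2 := integrable_pairing (H.one_lt i) (memLp_diffQ_of_mem H hu i)
    (memLp_diffQ_of_mem H h₂ i)
  simp only [pairing]
  rw [← integral_const_mul, ← integral_const_mul, ← integral_add (i1.const_mul a) (i2.const_mul b)]
  refine integral_congr_ae ?_
  filter_upwards [diffQ_comb_ae_eq i (s i) (p i) (δ i) v₁ v₂ a b] with z hz
  rw [hz]; ring

theorem pLaplacian_comb (H : Admissible s p δ Ω) {v₁ v₂ : Fn n} (hu : u ∈ W0 s p δ Ω)
    (h₁ : v₁ ∈ W0 s p δ Ω) (h₂ : v₂ ∈ W0 s p δ Ω) (a b : ℝ) :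
    pLaplacian w s p δ u (a • v₁ + b • v₂)
      = a * pLaplacian w s p δ u v₁ + b * pLaplacian w s p δ u v₂ := by
  simp only [pLaplacian_eq, Finset.mul_sum, ← Finset.sum_add_distrib]
  exact Finset.sum_congr rfl fun i _ => by rw [pairing_comb H i hu h₁ h₂]; ring

theorem exists_pLaplacian_bound (H : Admissible s p δ Ω) (hw : ∀ i, 0 < w i)
    (hu : u ∈ W0 s p δ Ω) :
    ∃ C : ℝ, 0 ≤ C ∧ ∀ v ∈ W0 s p δ Ω, |pLaplacian w s p δ u v| ≤ C * wNorm s p δ v := by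
  have hc := coef_pos H hw
  have hp0 : ∀ i, 0 < p i := fun i => by linarith [H.one_lt i]
  have hb : ∀ i, 0 ≤ semi s p δ i u ^ (1 / Real.conjExponent (p i)) := fun i =>
    Real.rpow_nonneg (semi_nonneg i u) _
  refine ⟨∑ i, coef w s p δ i * (p i * semi s p δ i u ^ (1 / Real.conjExponent (p i))),
    Finset.sum_nonneg fun i _ => mul_nonneg (hc i).le (mul_nonneg (hp0 i).le (hb i)),
    fun v hv => ?_⟩
  rw [pLaplacian_eq, Finset.sum_mul]
  refine (Finset.abs_sum_le_sum_abs _ _).trans (Finset.sum_le_sum fun i _ => ?_)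
  rw [abs_mul, abs_mul, abs_of_pos (hc i), abs_of_pos (hp0 i), mul_assoc, mul_assoc]
  refine mul_le_mul_of_nonneg_left (mul_le_mul_of_nonneg_left ?_ (hp0 i).le) (hc i).le
  have h := abs_integral_pairing_le (H.one_lt i) (memLp_diffQ_of_mem H hu i)
    (memLp_diffQ_of_mem H hv i)
  rw [← semi_eq_integral H, ← semi_eq_integral H] at h
  exact h.trans (mul_le_mul_of_nonneg_left (semi_rpow_le_wNorm i v) (hb i))

theorem energy_remainder (H : Admissible s p δ Ω) (hw : ∀ i, 0 < w i) (hu : u ∈ W0 s p δ Ω)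
    {ε : ℝ} (hε : 0 < ε) :
    ∃ η, 0 < η ∧ ∀ v ∈ W0 s p δ Ω, wNorm s p δ v ≤ η →
      |energy w s p δ (u + v) - energy w s p δ u - pLaplacian w s p δ u v|
        ≤ ε * wNorm s p δ v := by
  have : Nonempty (Fin n) := ⟨⟨0, H.dim_pos⟩⟩
  have hc := coef_pos H hw
  have hS : 0 < ∑ i, coef w s p δ i := Finset.sum_pos (fun i _ => hc i) Finset.univ_nonempty
  choose η hη h using fun i => integral_abs_rpow_remainder (H.one_lt i) (memLp_diffQ_of_mem H hu i)
    (div_pos hε hS)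
  refine ⟨Finset.univ.inf' Finset.univ_nonempty η, (Finset.lt_inf'_iff _).2 fun i _ => hη i,
    fun v hv hvη => ?_⟩
  have hi : ∀ i, |semi s p δ i (u + v) - semi s p δ i u - p i * pairing s p δ i u v|
      ≤ ε / (∑ i, coef w s p δ i) * wNorm s p δ v := fun i => by
    have h1 := h i (diffQ i v) (memLp_diffQ_of_mem H hv i) (by
      rw [← semi_eq_integral H]
      exact (semi_rpow_le_wNorm i v).trans (hvη.trans (Finset.inf'_le _ (Finset.mem_univ i))))
    rw [← semi_eq_integral H, ← semi_eq_integral H, ← semi_add_eq H] at h1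
    exact h1.trans (mul_le_mul_of_nonneg_left (semi_rpow_le_wNorm i v) (by positivity))
  have e : energy w s p δ (u + v) - energy w s p δ u - pLaplacian w s p δ u v
      = ∑ i, coef w s p δ i *
        (semi s p δ i (u + v) - semi s p δ i u - p i * pairing s p δ i u v) := by
    rw [energy_eq, energy_eq, pLaplacian_eq, ← Finset.sum_sub_distrib, ← Finset.sum_sub_distrib]
    exact Finset.sum_congr rfl fun i _ => by ring
  rw [e]
  calc _ ≤ ∑ i, |coef w s p δ i *
        (semi s p δ i (u + v) - semi s p δ i u - p i * pairing s p δ i u v)| :=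
        Finset.abs_sum_le_sum_abs _ _
    _ ≤ ∑ i, coef w s p δ i * (ε / (∑ i, coef w s p δ i) * wNorm s p δ v) := by
        refine Finset.sum_le_sum fun i _ => ?_
        rw [abs_mul, abs_of_pos (hc i)]
        exact mul_le_mul_of_nonneg_left (hi i) (hc i).le
    _ = _ := by
        rw [← Finset.sum_mul]; field_simp

theorem isFrechetDerivative_energy (H : Admissible s p δ Ω) (hw : ∀ i, 0 < w i)
    (hu : u ∈ W0 s p δ Ω) :
    IsFrechetDerivative (W0 s p δ Ω) (wNorm s p δ) (energy w s p δ) u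
      (pLaplacian w s p δ u) where
  linear _ h₁ _ h₂ a b := pLaplacian_comb H hu h₁ h₂ a b
  bounded := by
    obtain ⟨C, -, hC⟩ := exists_pLaplacian_bound H hw hu
    exact ⟨C, hC⟩
  approx := by
    rw [isLittleO_iff]
    intro c hc
    obtain ⟨η, hη, h⟩ := energy_remainder H hw hu hc
    rw [eventually_inf_principal]
    filter_upwards [tendsto_comap.eventually (eventually_le_nhds hη)] with v hv hvW
    rw [Real.norm_eq_abs, Real.norm_eq_abs, abs_of_nonneg (wNorm_nonneg v)]
    exact h v hvW hv

theorem energy_tangent (H : Admissible s p δ Ω) (hw : ∀ i, 0 < w i) (hu : u ∈ W0 s p δ Ω)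
    (hv : v ∈ W0 s p δ Ω) :
    energy w s p δ u + pLaplacian w s p δ u (v - u) ≤ energy w s p δ v := by
  rw [energy_eq, energy_eq, pLaplacian_eq, ← Finset.sum_add_distrib]
  refine Finset.sum_le_sum fun i _ => ?_
  rw [← mul_add]
  refine mul_le_mul_of_nonneg_left ?_ (coef_pos H hw i).le
  have h := integral_abs_rpow_tangent (H.one_lt i) (memLp_diffQ_of_mem H hu i)
    (memLp_diffQ_of_mem H hv i)
  rw [← semi_eq_integral H, ← semi_eq_integral H] at h
  refine le_trans (le_of_eq ?_) h
  congr 2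
  refine integral_congr_ae ?_
  filter_upwards [diffQ_sub_ae_eq i (s i) (p i) (δ i) v u] with z hz
  rw [hz]

/-! ### The functional -/

/-- The linear functional `v ↦ ∫_Ω f v` is well defined and bounded on `W₀`. -/
def LoadBound (s p δ : Fin n → ℝ) (Ω : Set (Pt n)) (f : Pt n → ℝ) (C : ℝ) : Prop :=
  0 ≤ C ∧ ∀ v ∈ W0 s p δ Ω, IntegrableOn (fun x => f x * v x) Ω volume ∧
    |∫ x in Ω, f x * v x| ≤ C * wNorm s p δ v

theorem load_comb {C : ℝ} (hf : LoadBound s p δ Ω f C) (hu : u ∈ W0 s p δ Ω)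
    (hv : v ∈ W0 s p δ Ω) (a b : ℝ) :
    ∫ x in Ω, f x * (a • u + b • v : Fn n) x
      = a * (∫ x in Ω, f x * u x) + b * ∫ x in Ω, f x * v x := by
  rw [← integral_const_mul, ← integral_const_mul,
    ← integral_add ((hf.2 u hu).1.const_mul a) ((hf.2 v hv).1.const_mul b)]
  refine integral_congr_ae ?_
  filter_upwards [ae_restrict_of_ae (coeFn_comb a b u v)] with x hx
  rw [hx]; ring

theorem load_add {C : ℝ} (hf : LoadBound s p δ Ω f C) (hu : u ∈ W0 s p δ Ω)
    (hv : v ∈ W0 s p δ Ω) :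
    ∫ x in Ω, f x * (u + v : Fn n) x = (∫ x in Ω, f x * u x) + ∫ x in Ω, f x * v x := by
  simpa using load_comb hf hu hv 1 1

theorem load_sub {C : ℝ} (hf : LoadBound s p δ Ω f C) (hu : u ∈ W0 s p δ Ω)
    (hv : v ∈ W0 s p δ Ω) :
    ∫ x in Ω, f x * (u - v : Fn n) x = (∫ x in Ω, f x * u x) - ∫ x in Ω, f x * v x := by
  simpa [sub_eq_add_neg] using load_comb hf hu hv 1 (-1)

theorem load_smul {C : ℝ} (hf : LoadBound s p δ Ω f C) (hu : u ∈ W0 s p δ Ω) (a : ℝ) :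
    ∫ x in Ω, f x * (a • u : Fn n) x = a * ∫ x in Ω, f x * u x := by
  simpa using load_comb hf hu hu a 0

theorem functional_isMinOn_of_isWeakSolution (H : Admissible s p δ Ω) (hw : ∀ i, 0 < w i) {C : ℝ}
    (hf : LoadBound s p δ Ω f C) (h : IsWeakSolution w s p δ Ω f u) :
    IsMinOn (functional w s p δ Ω f) (W0 s p δ Ω) u := by
  refine isMinOn_iff.2 fun v hv => ?_
  have h1 := energy_tangent H hw h.1 hv
  rw [h.2 _ (sub_mem_W0 H hv h.1), load_sub hf hv h.1] at h1
  simp only [functional]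
  linarith

theorem isWeakSolution_of_isMinOn (H : Admissible s p δ Ω) (hw : ∀ i, 0 < w i) {C : ℝ}
    (hf : LoadBound s p δ Ω f C) (hu : u ∈ W0 s p δ Ω)
    (h : IsMinOn (functional w s p δ Ω f) (W0 s p δ Ω) u) : IsWeakSolution w s p δ Ω f u := by
  refine ⟨hu, fun v hv => ?_⟩
  have hN := wNorm_nonneg (s := s) (p := p) (δ := δ) v
  have key : ∀ ε : ℝ, 0 < ε → ∀ v ∈ W0 s p δ Ω,
      (∫ x in Ω, f x * v x) - pLaplacian w s p δ u v ≤ ε * wNorm s p δ v := by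
    intro ε hε v hv
    have hN := wNorm_nonneg (s := s) (p := p) (δ := δ) v
    obtain ⟨η, hη, hr⟩ := energy_remainder H hw hu hε
    -- Small enough for `t • v` to lie within the range of the remainder estimate.
    set t := η / (wNorm s p δ v + 1) with ht
    have ht0 : 0 < t := by positivity
    have htv := smul_mem_W0 H hv t
    have hnorm : wNorm s p δ (t • v) = t * wNorm s p δ v := by
      rw [wNorm_smul H, abs_of_pos ht0]
    have h1 := hr (t • v) htv (by
      rw [hnorm, ht, div_mul_eq_mul_div, div_le_iff₀ (by positivity)]
      nlinarith)
    have h2 := isMinOn_iff.1 h (u + t • v) (add_mem_W0 H hu htv)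
    have h3 : pLaplacian w s p δ u (t • v) = t * pLaplacian w s p δ u v := by
      simpa using pLaplacian_comb (w := w) H hu hv hv t 0
    simp only [functional] at h2
    rw [load_add hf hu htv, load_smul hf hv] at h2
    rw [h3, hnorm] at h1
    have h4 := (abs_le.1 h1).2
    have h5 : t * ((∫ x in Ω, f x * v x) - pLaplacian w s p δ u v)
        ≤ t * (ε * wNorm s p δ v) := by linarith
    exact le_of_mul_le_mul_left h5 ht0
  have hle : ∀ v ∈ W0 s p δ Ω, (∫ x in Ω, f x * v x) - pLaplacian w s p δ u v ≤ 0 := by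
    intro v hv
    refine le_of_forall_pos_le_add fun ε hε => ?_
    have hN := wNorm_nonneg (s := s) (p := p) (δ := δ) v
    refine (key (ε / (wNorm s p δ v + 1)) (by positivity) v hv).trans ?_
    rw [zero_add, div_mul_eq_mul_div, div_le_iff₀ (by positivity)]
    nlinarith
  -- Testing with both `v` and `-v` turns the inequality into an equality.
  have h1 := hle v hv
  have h2 := hle _ (smul_mem_W0 H hv (-1))
  have h3 : pLaplacian w s p δ u ((-1 : ℝ) • v) = (-1) * pLaplacian w s p δ u v := by
    simpa using pLaplacian_comb (w := w) H hu hv hv (-1) 0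
  rw [load_smul hf hv, h3] at h2
  linarith

theorem strictConvexOn_functional (H : Admissible s p δ Ω) (hw : ∀ i, 0 < w i) {C : ℝ}
    (hf : LoadBound s p δ Ω f C) :
    StrictConvexOn ℝ (W0 s p δ Ω) (functional w s p δ Ω f) := by
  have : Nonempty (Fin n) := ⟨⟨0, H.dim_pos⟩⟩
  refine ⟨fun u hu v hv a b _ _ _ => comb_mem_W0 H hu hv a b, fun u hu v hv huv a b ha hb hab => ?_⟩
  have hlt : energy w s p δ (a • u + b • v)
      < a * energy w s p δ u + b * energy w s p δ v := by
    rw [energy_eq, energy_eq, energy_eq, Finset.mul_sum, Finset.mul_sum,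
      ← Finset.sum_add_distrib]
    refine Finset.sum_lt_sum_of_nonempty Finset.univ_nonempty fun i _ => ?_
    -- Equal differences in one direction already give `u = v` by Poincaré, so every summand is
    -- strictly convex.
    have hne : ¬ diffQ i u =ᵐ[kernelMeasure n (s i) (p i) (δ i)] diffQ i v := fun heq => by
      refine huv (sub_eq_zero.1 (eq_zero_of_semi_eq_zero H (sub_mem_W0 H hu hv) i ?_))
      rw [semi_sub_eq H, ← integral_zero (Pt n × ℝ) ℝ]
      refine integral_congr_ae ?_
      filter_upwards [heq] with z hz
      rw [hz, sub_self, abs_zero, Real.zero_rpow (by linarith [H.one_lt i])]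
    have h := integral_abs_rpow_strictConvex (H.one_lt i) (memLp_diffQ_of_mem H hu i)
      (memLp_diffQ_of_mem H hv i) ha hb hab hne
    rw [← semi_comb_eq H, ← semi_eq_integral H, ← semi_eq_integral H] at h
    have := mul_lt_mul_of_pos_left h (coef_pos H hw i)
    linarith
  simp only [functional, smul_eq_mul]
  rw [load_comb hf hu hv]
  linarith

/-- Since `pᵢ > 1`, Young's inequality lets the energy absorb `(1 + C)` times the norm up to a
constant; the load uses `C` of it and one copy of the norm remains. -/
theorem exists_coercive_bound (H : Admissible s p δ Ω) (hw : ∀ i, 0 < w i) {C : ℝ}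
    (hf : LoadBound s p δ Ω f C) :
    ∃ K : ℝ, ∀ v ∈ W0 s p δ Ω, wNorm s p δ v - K ≤ functional w s p δ Ω f v := by
  obtain ⟨C₀, hC₀, hN⟩ := exists_wNorm_le H
  choose K hK using fun i =>
    exists_mul_rpow_inv_le (H.one_lt i) (coef w s p δ i) ((1 + C) * C₀) (coef_pos H hw i)
  refine ⟨∑ i, K i, fun v hv => ?_⟩
  have h1 : (1 + C) * wNorm s p δ v ≤ energy w s p δ v + ∑ i, K i := by
    calc _ ≤ (1 + C) * (C₀ * ∑ i, semi s p δ i v ^ (1 / p i)) :=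
          mul_le_mul_of_nonneg_left (hN v hv) (by linarith [hf.1])
      _ = ∑ i, (1 + C) * C₀ * semi s p δ i v ^ (1 / p i) := by
          rw [← mul_assoc, Finset.mul_sum]
      _ ≤ ∑ i, (coef w s p δ i * semi s p δ i v + K i) :=
          Finset.sum_le_sum fun i _ => hK i _ (semi_nonneg i v)
      _ = _ := by rw [Finset.sum_add_distrib, energy_eq]
  have h2 := (abs_le.1 (hf.2 v hv).2).2
  simp only [functional]
  linarith

theorem tendsto_functional_atTop (H : Admissible s p δ Ω) (hw : ∀ i, 0 < w i) {C : ℝ}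
    (hf : LoadBound s p δ Ω f C) :
    Tendsto (functional w s p δ Ω f) (comap (wNorm s p δ) atTop ⊓ 𝓟 (W0 s p δ Ω)) atTop := by
  obtain ⟨K, hK⟩ := exists_coercive_bound H hw hf
  have h1 : Tendsto (fun v => wNorm s p δ v - K)
      (comap (wNorm s p δ) atTop ⊓ 𝓟 (W0 s p δ Ω)) atTop :=
    tendsto_atTop_add_const_right _ (-K) (tendsto_comap.mono_left inf_le_left)
  refine tendsto_atTop_mono' _ ?_ h1
  rw [EventuallyLE, eventually_inf_principal]
  exact Eventually.of_forall hK

/-- Differentiability gives a local Lipschitz bound at `u`: remainder, derivative and load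
contribute `1`, `L` and `C`. -/
theorem tendsto_functional_nhds (H : Admissible s p δ Ω) (hw : ∀ i, 0 < w i) {C : ℝ}
    (hf : LoadBound s p δ Ω f C) (hu : u ∈ W0 s p δ Ω) :
    Tendsto (functional w s p δ Ω f)
      (comap (fun v => wNorm s p δ (v - u)) (𝓝 0) ⊓ 𝓟 (W0 s p δ Ω))
      (𝓝 (functional w s p δ Ω f u)) := by
  obtain ⟨L, hL, hLu⟩ := exists_pLaplacian_bound H hw hu
  obtain ⟨η, hη, hr⟩ := energy_remainder H hw hu one_pos
  rw [tendsto_iff_norm_sub_tendsto_zero]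
  have h0 : Tendsto (fun v => (1 + L + C) * wNorm s p δ (v - u))
      (comap (fun v => wNorm s p δ (v - u)) (𝓝 0) ⊓ 𝓟 (W0 s p δ Ω)) (𝓝 0) := by
    simpa using ((tendsto_comap (f := fun v => wNorm s p δ (v - u)) (x := 𝓝 0)).mono_left
      (inf_le_left (b := 𝓟 (W0 s p δ Ω)))).const_mul (1 + L + C)
  refine squeeze_zero' (Eventually.of_forall fun v => norm_nonneg _) ?_ h0
  rw [eventually_inf_principal]
  filter_upwards [tendsto_comap.eventually (eventually_le_nhds hη)] with v hvη hv
  have hd := sub_mem_W0 H hv hu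
  have h1 := abs_le.1 (hr _ hd hvη)
  have h2 := abs_le.1 (hLu _ hd)
  have h3 := abs_le.1 (hf.2 _ hd).2
  rw [load_sub hf hv hu] at h3
  rw [add_sub_cancel] at h1
  rw [Real.norm_eq_abs, abs_le]
  simp only [functional]
  constructor <;> linarith [h1.1, h1.2, h2.1, h2.2, h3.1, h3.2]

/-! ### Existence of a minimizer -/

/-- Each directional convexity gap is nonnegative, so it is controlled by the gap of the whole
energy. This is the substitute for weak compactness. -/
theorem semi_sub_le_gap (H : Admissible s p δ Ω) (hw : ∀ i, 0 < w i) {ε : ℝ} (hε : 0 < ε) :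
    ∃ K : ℝ, 0 ≤ K ∧ ∀ u ∈ W0 s p δ Ω, ∀ v ∈ W0 s p δ Ω, ∀ i,
      semi s p δ i (u - v) ≤ ε * (semi s p δ i u + semi s p δ i v)
        + K * ((1 / 2) * energy w s p δ u + (1 / 2) * energy w s p δ v
          - energy w s p δ ((1 / 2 : ℝ) • u + (1 / 2 : ℝ) • v)) := by
  choose K hK hgap using fun i => integral_abs_rpow_midpoint_gap
    (ν := kernelMeasure n (s i) (p i) (δ i)) (H.one_lt i) hε
  have hc := coef_pos H hw
  refine ⟨∑ i, K i / coef w s p δ i,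
    Finset.sum_nonneg fun i _ => div_nonneg (hK i) (hc i).le, fun u hu v hv i => ?_⟩
  set g : Fin n → ℝ := fun i => (1 / 2) * semi s p δ i u + (1 / 2) * semi s p δ i v
    - semi s p δ i ((1 / 2 : ℝ) • u + (1 / 2 : ℝ) • v) with hg
  have hg0 : ∀ i, 0 ≤ g i := fun i => by
    have := integral_abs_rpow_convex (H.one_lt i) (memLp_diffQ_of_mem H hu i)
      (memLp_diffQ_of_mem H hv i) one_half_pos one_half_pos (add_halves (1 : ℝ))
    rw [← semi_eq_integral H, ← semi_eq_integral H, ← semi_comb_eq H] at this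
    simp only [hg]; linarith
  have hE : (1 / 2) * energy w s p δ u + (1 / 2) * energy w s p δ v
      - energy w s p δ ((1 / 2 : ℝ) • u + (1 / 2 : ℝ) • v) = ∑ i, coef w s p δ i * g i := by
    rw [energy_eq, energy_eq, energy_eq, Finset.mul_sum, Finset.mul_sum, ← Finset.sum_add_distrib,
      ← Finset.sum_sub_distrib]
    exact Finset.sum_congr rfl fun i _ => by simp only [hg]; ring
  have h1 := hgap i (diffQ i u) (diffQ i v) (memLp_diffQ_of_mem H hu i) (memLp_diffQ_of_mem H hv i)
  rw [← semi_eq_integral H, ← semi_eq_integral H, ← semi_comb_eq H, ← semi_sub_eq H] at h1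
  refine h1.trans (add_le_add le_rfl ?_)
  rw [hE]
  calc K i * g i = K i / coef w s p δ i * (coef w s p δ i * g i) := by
        have := (hc i).ne'
        field_simp
    _ ≤ _ := by
        refine mul_le_mul ?_ ?_ (mul_nonneg (hc i).le (hg0 i))
          (Finset.sum_nonneg fun i _ => div_nonneg (hK i) (hc i).le)
        · exact Finset.single_le_sum (f := fun i => K i / coef w s p δ i)
            (fun j _ => div_nonneg (hK j) (hc j).le) (Finset.mem_univ i)
        · exact Finset.single_le_sum (f := fun i => coef w s p δ i * g i)
            (fun j _ => mul_nonneg (hc j).le (hg0 j)) (Finset.mem_univ i)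

/-- Completeness of `W₀`: the limit is found in `L^{p_j}` for one fixed direction `j`, and Fatou
along an almost everywhere convergent subsequence transfers the Cauchy bounds to all seminorms. -/
theorem exists_limit_of_cauchy (H : Admissible s p δ Ω) {g : ℕ → Fn n}
    (hg : ∀ k, g k ∈ W0 s p δ Ω)
    (hcau : ∀ ε : ℝ, 0 < ε → ∃ K, ∀ k ≥ K, ∀ l ≥ K, ∀ i, semi s p δ i (g k - g l) ≤ ε) :
    ∃ u ∈ W0 s p δ Ω, Tendsto (fun k => wNorm s p δ (g k - u)) atTop (𝓝 0) := by
  obtain ⟨C₀, hC₀, hN⟩ := exists_wNorm_le H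
  have hp0 : ∀ i, 0 < p i := fun i => by linarith [H.one_lt i]
  set j : Fin n := ⟨0, H.dim_pos⟩ with hj
  have hwc : ∀ ε : ℝ, 0 < ε → ∃ K, ∀ k ≥ K, ∀ l ≥ K, wNorm s p δ (g k - g l) < ε := by
    intro ε hε
    have hlim : Tendsto (fun r : ℝ => C₀ * ∑ i, r ^ (1 / p i)) (𝓝 0) (𝓝 0) := by
      have : Continuous fun r : ℝ => C₀ * ∑ i, r ^ (1 / p i) :=
        continuous_const.mul (continuous_finsetSum _ fun i _ =>
          Real.continuous_rpow_const (one_div_pos.2 (hp0 i)).le)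
      refine (this.tendsto 0).trans_eq ?_
      have : ∀ i, (0 : ℝ) ^ (1 / p i) = 0 := fun i =>
        Real.zero_rpow (one_div_pos.2 (hp0 i)).ne'
      simp only [this, Finset.sum_const_zero, mul_zero]
    obtain ⟨r, hr, hr0⟩ := (((hlim.mono_left nhdsWithin_le_nhds).eventually_lt_const hε).and
      (self_mem_nhdsWithin (s := Set.Ioi (0 : ℝ)))).exists
    obtain ⟨K, hK⟩ := hcau r hr0
    refine ⟨K, fun k hk l hl => lt_of_le_of_lt ((hN _ (sub_mem_W0 H (hg k) (hg l))).trans ?_) hr⟩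
    refine mul_le_mul_of_nonneg_left (Finset.sum_le_sum fun i _ => ?_) hC₀
    exact Real.rpow_le_rpow (semi_nonneg _ _) (hK k hk l hl i) (one_div_pos.2 (hp0 i)).le
  have hP1 : Fact (1 ≤ ENNReal.ofReal (p j)) := ⟨by
    rw [ENNReal.one_le_ofReal]; exact (H.one_lt j).le⟩
  set X : ℕ → Lp ℝ (ENNReal.ofReal (p j)) (volume : Measure (Pt n)) := fun k =>
    ⟨g k, Lp.mem_Lp_iff_memLp.2 ((hg k).1 j).1⟩ with hX
  have hXc : CauchySeq X := by
    rw [Metric.cauchySeq_iff]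
    intro ε hε
    obtain ⟨K, hK⟩ := hwc ε hε
    refine ⟨K, fun k hk l hl => lt_of_le_of_lt ?_ (hK k hk l hl)⟩
    rw [dist_eq_norm, Lp.norm_def]
    have h := Finset.single_le_sum (f := fun i =>
      (gagliardo i (s i) (p i) (δ i) (g k - g l)).toReal ^ (1 / p i)
      + (eLpNorm (g k - g l : Fn n) (ENNReal.ofReal (p i)) volume).toReal)
      (fun j _ => by positivity) (Finset.mem_univ j)
    exact le_trans (le_add_of_nonneg_left (by positivity)) h
  obtain ⟨x, hx⟩ := cauchySeq_tendsto_of_complete hXc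
  obtain ⟨φ, hφ, hae⟩ := (tendstoInMeasure_of_tendsto_Lp hx).exists_seq_tendsto_ae
  set u : Fn n := x.1
  have hae' : ∀ᵐ y, Tendsto (fun l => g (φ l) y) atTop (𝓝 (u y)) := hae
  have hvan : ∀ᵐ y, y ∉ Ω → u y = 0 := by
    filter_upwards [hae', ae_all_iff.2 fun k => (hg k).2] with y hy h0 hyΩ
    refine tendsto_nhds_unique hy ?_
    simp only [h0 _ hyΩ, tendsto_const_nhds]
  have hdiff : ∀ k, ∀ᵐ y, Tendsto (fun l => (g k - g (φ l) : Fn n) y) atTop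
      (𝓝 ((g k - u : Fn n) y)) := fun k => by
    filter_upwards [hae', AEEqFun.coeFn_sub (g k) u,
      ae_all_iff.2 fun l => AEEqFun.coeFn_sub (g k) (g (φ l))] with y hy h1 h2
    simp only [h1, h2, Pi.sub_apply]
    exact hy.const_sub _
  have hlim : ∀ ε : ℝ, 0 < ε → ∃ K, ∀ k ≥ K, ∀ i,
      gagliardo i (s i) (p i) (δ i) (g k - u) ≤ ENNReal.ofReal ε := by
    intro ε hε
    obtain ⟨K, hK⟩ := hcau ε hε
    refine ⟨K, fun k hk i => gagliardo_le_of_ae_tendsto H i (hdiff k) ?_⟩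
    filter_upwards [hφ.tendsto_atTop.eventually_ge_atTop K] with l hl
    rw [← ENNReal.ofReal_toReal ((sub_mem_W0 H (hg k) (hg (φ l))).1 i).2.ne]
    exact ENNReal.ofReal_le_ofReal (hK k hk _ hl i)
  -- Fatou bounds `g K - u`, and `u` is recovered as `g K - (g K - u)`.
  have hmem : u ∈ W0 s p δ Ω := by
    obtain ⟨K, hK⟩ := hlim 1 one_pos
    have h1 : g K - u ∈ W0 s p δ Ω := by
      rw [mem_W0_iff H]
      refine ⟨fun i => (hK K le_rfl i).trans_lt ENNReal.ofReal_lt_top, ?_⟩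
      filter_upwards [hvan, (hg K).2, AEEqFun.coeFn_sub (g K) u] with y h1 h2 h3 hy
      rw [h3, Pi.sub_apply, h1 hy, h2 hy, sub_zero]
    simpa using sub_mem_W0 H (hg K) h1
  refine ⟨u, hmem, ?_⟩
  have hsemi : ∀ i, Tendsto (fun k => semi s p δ i (g k - u) ^ (1 / p i)) atTop (𝓝 0) := by
    intro i
    have h1 : Tendsto (fun k => semi s p δ i (g k - u)) atTop (𝓝 0) := by
      rw [Metric.tendsto_atTop]
      intro ε hε
      obtain ⟨K, hK⟩ := hlim (ε / 2) (half_pos hε)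
      refine ⟨K, fun k hk => ?_⟩
      rw [Real.dist_0_eq_abs, abs_of_nonneg (semi_nonneg _ _)]
      have := ENNReal.toReal_mono ENNReal.ofReal_ne_top (hK k hk i)
      rw [ENNReal.toReal_ofReal (half_pos hε).le] at this
      exact this.trans_lt (half_lt_self hε)
    have h2 := h1.rpow_const (p := 1 / p i) (Or.inr (one_div_pos.2 (hp0 i)).le)
    rwa [Real.zero_rpow (one_div_pos.2 (hp0 i)).ne'] at h2
  have h3 : Tendsto (fun k => C₀ * ∑ i, semi s p δ i (g k - u) ^ (1 / p i)) atTop (𝓝 0) := by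
    simpa using (tendsto_finsetSum Finset.univ fun i _ => hsemi i).const_mul C₀
  exact squeeze_zero (fun k => wNorm_nonneg _) (fun k => hN _ (sub_mem_W0 H (hg k) hmem)) h3

theorem exists_isMinOn_functional (H : Admissible s p δ Ω) (hw : ∀ i, 0 < w i) {C : ℝ}
    (hf : LoadBound s p δ Ω f C) :
    ∃ u ∈ W0 s p δ Ω, IsMinOn (functional w s p δ Ω f) (W0 s p δ Ω) u := by
  obtain ⟨K, hK⟩ := exists_coercive_bound H hw hf
  set S := functional w s p δ Ω f '' W0 s p δ Ω with hS
  have hbdd : BddBelow S := by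
    refine ⟨-K, ?_⟩
    rintro _ ⟨v, hv, rfl⟩
    linarith [hK v hv, wNorm_nonneg (s := s) (p := p) (δ := δ) v]
  have hne : S.Nonempty := ⟨_, 0, zero_mem_W0 H, rfl⟩
  obtain ⟨y, hanti, hy, hyS⟩ := exists_seq_tendsto_sInf hne hbdd
  choose g hg hgy using hyS
  set m := sInf S with hm
  have hmle : ∀ v ∈ W0 s p δ Ω, m ≤ functional w s p δ Ω f v := fun v hv =>
    csInf_le hbdd ⟨v, hv, rfl⟩
  have hbound : ∀ k, wNorm s p δ (g k) ≤ y 0 + K := fun k => by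
    linarith [hK _ (hg k), hgy k, hanti (Nat.zero_le k)]
  have hcau : ∀ ε : ℝ, 0 < ε → ∃ N, ∀ k ≥ N, ∀ l ≥ N, ∀ i,
      semi s p δ i (g k - g l) ≤ ε := by
    intro ε hε
    set A := ∑ i, |y 0 + K| ^ p i with hA
    have hA0 : 0 ≤ A := Finset.sum_nonneg fun i _ => by positivity
    have hsA : ∀ k i, semi s p δ i (g k) ≤ A := fun k i => by
      refine (semi_le_wNorm_rpow H i (g k)).trans (le_trans ?_ (Finset.single_le_sum
        (f := fun i => |y 0 + K| ^ p i) (fun j _ => by positivity) (Finset.mem_univ i)))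
      exact Real.rpow_le_rpow (wNorm_nonneg _) ((hbound k).trans (le_abs_self _))
        (by linarith [H.one_lt i])
    -- The semis along the sequence are at most `A`, so this parameter makes the first term of the
    -- gap inequality at most `ε / 2`; `B` then fixes how close to the infimum the sequence must be.
    obtain ⟨B, hB, hgap⟩ := semi_sub_le_gap H hw (ε := ε / 2 / (2 * A + 1)) (by positivity)
    have hev : ∀ᶠ k in atTop, y k < m + ε / 2 / (B + 1) :=
      hy.eventually_lt_const (lt_add_of_pos_right _ (by positivity))
    obtain ⟨N, hN⟩ := eventually_atTop.1 hev
    refine ⟨N, fun k hk l hl i => (hgap _ (hg k) _ (hg l) i).trans ?_⟩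
    have hmid := hmle _ (comb_mem_W0 H (hg k) (hg l) (1 / 2) (1 / 2))
    have hk' := (hgy k).trans_lt (hN k hk)
    have hl' := (hgy l).trans_lt (hN l hl)
    simp only [functional] at hmid hk' hl'
    -- The load is linear, so it cancels in the midpoint gap and near-minimality bounds the energy
    -- gap alone.
    rw [load_comb hf (hg k) (hg l)] at hmid
    have h1 : (1 / 2) * energy w s p δ (g k) + (1 / 2) * energy w s p δ (g l)
        - energy w s p δ ((1 / 2 : ℝ) • g k + (1 / 2 : ℝ) • g l) ≤ ε / 2 / (B + 1) := by linarith
    have h2 : ε / 2 / (2 * A + 1) * (semi s p δ i (g k) + semi s p δ i (g l)) ≤ ε / 2 := by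
      rw [div_mul_eq_mul_div, div_le_iff₀ (by positivity)]
      exact mul_le_mul_of_nonneg_left (by linarith [hsA k i, hsA l i]) (by positivity)
    have h3 : B * (ε / 2 / (B + 1)) ≤ ε / 2 := by
      rw [mul_div_assoc', div_le_iff₀ (by positivity)]
      nlinarith
    have h4 := mul_le_mul_of_nonneg_left h1 hB
    linarith
  obtain ⟨u, hu, hlim⟩ := exists_limit_of_cauchy H hg hcau
  refine ⟨u, hu, isMinOn_iff.2 fun v hv => ?_⟩
  have h1 : Tendsto g atTop (comap (fun v => wNorm s p δ (v - u)) (𝓝 0) ⊓ 𝓟 (W0 s p δ Ω)) :=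
    tendsto_inf.2 ⟨tendsto_comap_iff.2 hlim, tendsto_principal.2 (Eventually.of_forall hg)⟩
  have h2 := (tendsto_functional_nhds H hw hf hu).comp h1
  have h3 : functional w s p δ Ω f ∘ g = y := funext hgy
  rw [h3] at h2
  rw [tendsto_nhds_unique h2 hy]
  exact hmle v hv

end Peridynamic

/-! ### Assembly of the main theorem. -/

theorem mainTheorem6 (n : ℕ) (Ω : Set (Peridynamic.Pt n)) (hΩ : IsOpen Ω)
    (hΩb : Bornology.IsBounded Ω) (s p δ w : Fin n → ℝ)
    (hs : ∀ i, 0 < s i ∧ s i < 1) (hp : ∀ i, 1 < p i) (hδ : ∀ i, 0 < δ i) (hw : ∀ i, 0 < w i)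
    (hsp : Peridynamic.meanSP s p < n) (hpmax : ∀ i, p i < Peridynamic.criticalExponent s p)
    (f : Peridynamic.Pt n → ℝ)
    (hf : MemLp f (ENNReal.ofReal (Real.conjExponent (Peridynamic.criticalExponent s p)))
      (volume.restrict Ω)) :
    -- all integrals in the weak formulation converge
    (∀ v ∈ Peridynamic.W0 s p δ Ω, IntegrableOn (fun x => f x * v x) Ω volume) ∧
    (∀ u ∈ Peridynamic.W0 s p δ Ω, ∀ v ∈ Peridynamic.W0 s p δ Ω, ∀ i,
      Integrable (Peridynamic.pairingIntegrand i (s i) (p i) u v) (Peridynamic.slab n (δ i))) ∧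
    -- the operator is the derivative of the energy
    (∀ u ∈ Peridynamic.W0 s p δ Ω,
      Peridynamic.IsFrechetDerivative (Peridynamic.W0 s p δ Ω) (Peridynamic.wNorm s p δ)
        (Peridynamic.energy w s p δ) u (Peridynamic.pLaplacian w s p δ u)) ∧
    -- existence and uniqueness of the weak solution
    (∃! u : Peridynamic.Fn n, Peridynamic.IsWeakSolution w s p δ Ω f u) ∧
    -- the weak solution is the minimizer of the functional
    (∀ u ∈ Peridynamic.W0 s p δ Ω, Peridynamic.IsWeakSolution w s p δ Ω f u ↔
      IsMinOn (Peridynamic.functional w s p δ Ω f) (Peridynamic.W0 s p δ Ω) u) ∧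
    -- the functional is strictly convex, coercive and continuous
    StrictConvexOn ℝ (Peridynamic.W0 s p δ Ω) (Peridynamic.functional w s p δ Ω f) ∧
    Tendsto (Peridynamic.functional w s p δ Ω f)
      (comap (Peridynamic.wNorm s p δ) atTop ⊓ 𝓟 (Peridynamic.W0 s p δ Ω)) atTop ∧
    (∀ u ∈ Peridynamic.W0 s p δ Ω, Tendsto (Peridynamic.functional w s p δ Ω f)
      (comap (fun v => Peridynamic.wNorm s p δ (v - u)) (𝓝 0) ⊓ 𝓟 (Peridynamic.W0 s p δ Ω))
      (𝓝 (Peridynamic.functional w s p δ Ω f u))) := by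
  -- For `n = 0` the mean exponent is `0⁻¹ = 0`, so `hsp` would read `0 < 0`.
  have hn : 0 < n := by
    rcases Nat.eq_zero_or_pos n with rfl | hn
    · simp [Peridynamic.meanSP, Peridynamic.harmonicMean] at hsp
    · exact hn
  have H : Peridynamic.Admissible s p δ Ω := ⟨hn, fun i => (hs i).1, hp, hδ, hΩb⟩
  have hq : 1 < Peridynamic.criticalExponent s p := (hp ⟨0, hn⟩).trans (hpmax ⟨0, hn⟩)
  obtain ⟨C, hC⟩ := Peridynamic.exists_linear_bound H hsp hq hf
  have hL : Peridynamic.LoadBound s p δ Ω f C := hC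
  have hconv := Peridynamic.strictConvexOn_functional H hw hL
  have hiff : ∀ u ∈ Peridynamic.W0 s p δ Ω, Peridynamic.IsWeakSolution w s p δ Ω f u ↔
      IsMinOn (Peridynamic.functional w s p δ Ω f) (Peridynamic.W0 s p δ Ω) u := fun u hu =>
    ⟨Peridynamic.functional_isMinOn_of_isWeakSolution H hw hL,
      Peridynamic.isWeakSolution_of_isMinOn H hw hL hu⟩
  refine ⟨fun v hv => (hL.2 v hv).1, fun u hu v hv i => ?_,
    fun u hu => Peridynamic.isFrechetDerivative_energy H hw hu, ?_, hiff, hconv,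
    Peridynamic.tendsto_functional_atTop H hw hL,
    fun u hu => Peridynamic.tendsto_functional_nhds H hw hL hu⟩
  · rw [Peridynamic.integrable_pairingIntegrand_iff]
    exact Peridynamic.integrable_pairing (hp i) (Peridynamic.memLp_diffQ_of_mem H hu i)
      (Peridynamic.memLp_diffQ_of_mem H hv i)
  · obtain ⟨u, hu, hmin⟩ := Peridynamic.exists_isMinOn_functional H hw hL
    refine ⟨u, (hiff u hu).2 hmin, fun v hv => ?_⟩
    exact hconv.eq_of_isMinOn ((hiff v hv.1).1 hv) hmin hv.1 hu
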